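/- **Setting.** Let $\mathcal X$ be a measurable space, $\mathcal F$ a class of measurable classifiers $\mathcal X\to\{0,1\}$ of VC dimension $d$ (with the usual measurability: for all $n$ and $y\in\{0,1\}^n$ the set of $(x_1,\dots,x_n)$ such that some $f\in\mathcal F$ has $f(x_j)=y_j$ for all $j$ is measurable up to null sets of every product $P^{n}$ of a probability measure $P$ on $\mathcal X$). Let $D_1,\dots,D_k$, $k\ge 2$, be probability distributions on $\mathcal X\times\{0,1\}$. Write $\mathrm{err}_D(f)=\Pr_{(x,y)\sim D}[f(x)\ne y]$, let $\mathrm{err}_S(f)$ be the fraction of the sample $S$ that $f$ mislabels, and let $\mathrm{OPT}=\inf_{f\in\mathcal F}\max_{i\in[k]}\mathrm{err}_{D_i}(f)$. For $\epsilon,\delta,\alpha\in(0,1)$ put $\alpha'=\alpha/12$, $\epsilon'=\epsilon/25$, $t=2\lceil \ln k/(\epsilon'\alpha'^2)\rceil$, $\delta'=\delta/(4t)$. Let $\mathcal O$ be an oracle that maps a sample $S$ to some $\mathcal O(S)\in\mathcal F$ with $\mathrm{err}_S(\mathcal O(S))\le\inf_{f\in\mathcal F}\mathrm{err}_S(f)+\epsilon'$,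 where $(S,x)\mapsto\mathcal O(S)(x)$ is measurable. **Algorithm NR1-AVG** with sample sizes $n_S,n_T$. Start with $w^{(0)}_i=1$ for $i\in[k]$. In round $r=1,\dots,t$: draw $n_S$ i.i.d. samples $S^{(r)}$ from the mixture $\sum_i w_i^{(r-1)}D_i\big/\sum_i w_i^{(r-1)}$; let $f^{(r)}=\mathcal O(S^{(r)})$; for each $i$ draw $n_T$ fresh i.i.d. samples $T_i$ from $D_i$, put $s_i^{(r)}=\dfrac{\mathrm{err}_{T_i}(f^{(r)})\,\epsilon'\alpha'}{(1+3\alpha')\,\mathrm{err}_{S^{(r)}}(f^{(r)})+3\epsilon'}$ and $w_i^{(r)}=w_i^{(r-1)}(1+s_i^{(r)})$. Return the randomized classifier $\hat f$ that, given $x$, picks $r\in[t]$ uniformly at random and answers $f^{(r)}(x)$. Its expected error $\overline{\mathrm{err}}_{D}(\hat f)$ is the probability, over $(x,y)\sim D$ and the choice of $r$, that the answer differs from $y$. The algorithm uses $m=t(n_S+k\,n_T)$ samples. **Theorem.** There are sample sizes $n_S=n_S(k,d,\epsilon,\delta,\alpha)$ and $n_T=n_T(k,\epsilon,\delta,\alpha)$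 with $$n_S=O\Big(\frac1{\alpha'\epsilon'}\Big(d\ln\frac1{\epsilon'}+\ln\frac1{\delta'}\Big)\Big),\qquad n_T=O\Big(\frac1{\alpha'\epsilon'}\ln\frac k{\delta'}\Big)$$ such that for all $k\ge2$, $d\ge 0$, $\epsilon,\delta\in(0,1)$ and $24\epsilon/25<\alpha<1$ and all $\mathcal X,\mathcal F,D_1,\dots,D_k,\mathcal O$ as above, Algorithm NR1-AVG with these (or any larger) sample sizes returns, with probability at least $1-\delta$, a randomized classifier $\hat f$ with $$\overline{\mathrm{err}}_{D_i}(\hat f)\le(1+\alpha)\,\mathrm{OPT}+\epsilon\quad\text{for all } i\in[k],$$ and with the sizes $n_S,n_T$ it uses $$m=O\Big(\frac{\ln k}{\alpha^3\epsilon^2}\Big(d\,\max\{1,\ln(1/\epsilon)\}+k\ln\frac k\delta\Big)\Big)$$ samples. All constants in the $O$'s are absolute. -/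

import Mathlib

open MeasureTheory ProbabilityTheory

namespace CollabPAC

noncomputable section

section Model

variable {X : Type*}

/-- The error `Pr_{(x,y) ~ D} [f x ≠ y]` of a classifier. -/
def err [MeasurableSpace X] (D : Measure (X × Bool)) (f : X → Bool) : ℝ :=
  D.real {z | f z.1 ≠ z.2}

/-- The fraction of the sample `S` that `f` mislabels. -/
def empErr {n : ℕ} (S : Fin n → X × Bool) (f : X → Bool) : ℝ :=
  ((Finset.univ.filter fun j => f (S j).1 ≠ (S j).2).card : ℝ) / n

/-- `OPT = inf_{f ∈ F} max_i err_{D_i} f`. -/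
def opt [MeasurableSpace X] {k : ℕ} (D : Fin k → Measure (X × Bool)) (F : Set (X → Bool)) : ℝ :=
  ⨅ f : F, ⨆ i, err (D i) f

/-- Every labelling of the finite set `A` is realised by a member of `F`. -/
def Shatters (F : Set (X → Bool)) (A : Finset X) : Prop :=
  ∀ g : X → Bool, ∃ f ∈ F, ∀ x ∈ A, f x = g x

/-- `F` has (finite) VC dimension `d`: the largest size of a shattered set is `d`. -/
def HasVCDim (F : Set (X → Bool)) (d : ℕ) : Prop :=
  IsGreatest {n : ℕ | ∃ A : Finset X, A.card = n ∧ Shatters F A} d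

/-- The tacit measurability assumption of VC theory: the members of `F` are measurable, and the
set of `n`-point samples on which a given labelling is realised by a member of `F` is measurable
up to null sets, for every i.i.d. law of the sample. -/
structure IsMeasurableClass [MeasurableSpace X] (F : Set (X → Bool)) : Prop where
  measurable_of_mem : ∀ f ∈ F, Measurable f
  trace : ∀ (n : ℕ) (y : Fin n → Bool) (P : Measure X), IsProbabilityMeasure P →
    NullMeasurableSet {x : Fin n → X | ∃ f ∈ F, ∀ j, f (x j) = y j} (Measure.pi fun _ => P)

/-- `O` is an (approximate) empirical risk minimiser for `F` on samples of size `n`: it returns a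
member of `F` whose empirical error is within `η` of the infimum over `F`. The label that the
returned hypothesis gives to a point is a measurable function of the sample and the point. -/
structure IsERM [MeasurableSpace X] (F : Set (X → Bool)) (η : ℝ) {n : ℕ}
    (O : (Fin n → X × Bool) → X → Bool) : Prop where
  measurable : Measurable fun p : (Fin n → X × Bool) × X => O p.1 p.2
  mem : ∀ S, O S ∈ F
  empErr_le : ∀ S, empErr S (O S) ≤ (⨅ f : F, empErr S f) + η

/-- The randomized classifier that, given `x`, picks one of `f 0, …, f (t - 1)` uniformly at
random and returns its label of `x`: the law of the returned label. -/
def uniformClassifier {t : ℕ} (f : Fin t → X → Bool) (x : X) : Measure Bool :=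
  (uniformOn (Set.univ : Set (Fin t))).map fun r => f r x

/-- The probability, over the example and the classifier's randomness, that a randomized
classifier mislabels the example. -/
def expErr [MeasurableSpace X] (D : Measure (X × Bool)) (g : X → Measure Bool) : ℝ :=
  ∫ z, (g z.1).real {b | b ≠ z.2} ∂D

end Model

section Parameters

/-- `α' = α / 12`. -/
def alpha' (α : ℝ) : ℝ := α / 12

/-- `ε' = ε / 25`. -/
def eps' (ε : ℝ) : ℝ := ε / 25

/-- The number of rounds `t = 2 ⌈ln k / (ε' α'²)⌉`. -/
def rounds (k : ℕ) (ε α : ℝ) : ℕ := 2 * ⌈Real.log k / (eps' ε * alpha' α ^ 2)⌉₊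

/-- `δ' = δ / (4 t)`. -/
def delta' (k : ℕ) (ε δ α : ℝ) : ℝ := δ / (4 * rounds k ε α)

/-- The number of samples drawn in all rounds, when every round draws `mS` samples from the
mixture and `mT` samples from each of the `k` players. -/
def sampleCount (k : ℕ) (ε α : ℝ) (mS mT : ℕ) : ℕ := rounds k ε α * (mS + k * mT)

end Parameters

section Algorithm

/-- The samples of one round: `S` from the mixture, and `T i` from each player `i`. -/
abbrev Round (X : Type*) (k mS mT : ℕ) : Type _ :=
  (Fin mS → X × Bool) × (Fin k → Fin mT → X × Bool)

variable {X : Type*} {k mS mT : ℕ}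

/-- The step `s_i` of a round, for the classifier `O S` of that round. -/
def step (ε α : ℝ) (O : (Fin mS → X × Bool) → X → Bool) (z : Round X k mS mT) (i : Fin k) : ℝ :=
  empErr (z.2 i) (O z.1) * eps' ε * alpha' α /
    ((1 + 3 * alpha' α) * empErr z.1 (O z.1) + 3 * eps' ε)

/-- The weights `w_i` after `r` rounds with samples `h`. -/
def weights (ε α : ℝ) (O : (Fin mS → X × Bool) → X → Bool) :
    (r : ℕ) → (Fin r → Round X k mS mT) → Fin k → ℝ
  | 0, _, _ => 1
  | r + 1, h, i =>
      weights ε α O r (fun j => h j.castSucc) i * (1 + step ε α O (h (Fin.last r)) i)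

/-- The randomized classifier that the algorithm returns after `t` rounds with samples `h`; the
classifier of round `r` is `O S` for the sample `S = (h r).1` of that round. -/
def output (O : (Fin mS → X × Bool) → X → Bool) {t : ℕ} (h : Fin t → Round X k mS mT) :
    X → Measure Bool :=
  uniformClassifier fun r => O (h r).1

variable [MeasurableSpace X]

/-- The mixture `(1/Φ) ∑ w_i D_i`, where `Φ = ∑ w_i`. -/
def mixture (D : Fin k → Measure (X × Bool)) (w : Fin k → ℝ) : Measure (X × Bool) :=
  ∑ i, ENNReal.ofReal (w i / ∑ j, w j) • D i

/-- The law of the samples of one round, given the current weights: `mS` i.i.d. samples from the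
mixture and, independently, `mT` i.i.d. samples from each `D i`. -/
def roundLaw (D : Fin k → Measure (X × Bool)) (w : Fin k → ℝ) : Measure (Round X k mS mT) :=
  (Measure.pi fun _ : Fin mS => mixture D w).prod
    (Measure.pi fun i => Measure.pi fun _ : Fin mT => D i)

/-- The joint law of the samples of the first `r` rounds of the algorithm. -/
def law (ε α : ℝ) (D : Fin k → Measure (X × Bool)) (O : (Fin mS → X × Bool) → X → Bool) :
    (r : ℕ) → Measure (Fin r → Round X k mS mT)
  | 0 => Measure.dirac Fin.elim0
  | r + 1 => (law ε α D O r).bind fun h =>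
      (roundLaw D (weights ε α O r h)).map fun z => Fin.snoc (α := fun _ => Round X k mS mT) h z

end Algorithm

end

end CollabPAC

/-!
Call a round good if the mixture error of the classifier `f` found in it is at most
`(1 + α') empErr f + ε'` and `empErr f` is at most `(1 + α') (OPT + ε') + 2 ε'`. A round is good
with high probability: the first bound is relative uniform convergence over a VC class, proved by
symmetrizing an exponential moment with a ghost sample, and the second is a Chernoff bound for a
nearly optimal competitor.

Player `i` has the potential `ln (∑ w) - ln w_i + ε' α' ((1 - α'/3) ∑ err_{D_i}(f) / den - r)`,
where `den` is the normalization of the steps and the sum is over the first `r` rounds. In a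
good round the mixture error is so small compared with `den` that the exponential moment of
`n_T / 2` times the potential does not grow, whatever the history. By Markov's inequality the final
potential is then at most `ln k + O(α' ε')` for every player. Since `ln w_i ≤ ln (∑ w)`, this
bounds the sum of the normalized errors of the `t` rounds by `t (1 + α')`, and the bound on
`den` in good rounds turns it into a bound on the average error.
-/

namespace CollabPAC

section Growth

variable {X ι : Type*}

lemma sum_choose_le (N d : ℕ) {x : ℝ} (hx : 0 < x) (hx1 : x ≤ 1) :
    (∑ j ∈ Finset.Iic d, (N.choose j : ℝ)) ≤ (1 / x) ^ d * Real.exp (x * N) := by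
  rw [one_div, inv_pow, inv_mul_eq_div, le_div_iff₀ (by positivity), Finset.sum_mul]
  calc ∑ j ∈ Finset.Iic d, (N.choose j : ℝ) * x ^ d
      ≤ ∑ j ∈ Finset.Iic d, (N.choose j : ℝ) * x ^ j :=
        Finset.sum_le_sum fun j hj => mul_le_mul_of_nonneg_left
          (pow_le_pow_of_le_one hx.le hx1 (Finset.mem_Iic.1 hj)) (by positivity)
    _ ≤ ∑ j ∈ Finset.range (N + 1), (N.choose j : ℝ) * x ^ j := by
        rw [← Finset.sum_filter_of_ne (p := (· ≤ N)) fun j _ hj =>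
          not_lt.1 fun h => hj (by simp [Nat.choose_eq_zero_of_lt h])]
        refine Finset.sum_le_sum_of_subset_of_nonneg (fun j hj => ?_) fun j _ _ => by positivity
        exact Finset.mem_range_succ_iff.2 (Finset.mem_filter.1 hj).2
    _ = (x + 1) ^ N := by simp [add_pow, mul_comm]
    _ ≤ Real.exp x ^ N := pow_le_pow_left₀ (by positivity) (Real.add_one_le_exp x) N
    _ = Real.exp (x * N) := by rw [mul_comm, Real.exp_nat_mul]

/-- The labellings of the points `x i` by the members of `F`; their number is what the growth
function of `F` maximises over `x`. -/
def traces (F : Set (X → Bool)) (x : ι → X) : Set (ι → Bool) := (fun f => f ∘ x) '' F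

lemma ncard_le_sum_choose_of_shatters [Fintype ι] {H : Set (ι → Bool)} {d : ℕ}
    (hH : ∀ A, Shatters H A → A.card ≤ d) :
    H.ncard ≤ ∑ j ∈ Finset.Iic d, (Fintype.card ι).choose j := by
  classical
  let supp : (ι → Bool) → Finset ι := fun u => {i | u i = true}
  have supp_injective : Function.Injective supp := fun u v huv => funext fun i => by
    rw [Bool.eq_iff_iff]
    simpa [supp] using Finset.ext_iff.1 huv i
  have shatters_of_mem {A : Finset ι} (hA : (H.toFinset.image supp).Shatters A) :
      Shatters H A := fun g => by
    obtain ⟨B, hB, hgB⟩ := hA (Finset.filter_subset (fun i => g i = true) A)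
    obtain ⟨u, hu, rfl⟩ := Finset.mem_image.1 hB
    refine ⟨u, Set.mem_toFinset.1 hu, fun i hi => Bool.eq_iff_iff.2 ?_⟩
    simpa [supp, hi] using Finset.ext_iff.1 hgB i
  rw [Set.ncard_eq_toFinset_card', ← Finset.card_image_of_injective _ supp_injective]
  calc (H.toFinset.image supp).card
      ≤ ∑ j ∈ Finset.Iic (H.toFinset.image supp).vcDim, (Fintype.card ι).choose j :=
        (Finset.card_le_card_shatterer _).trans Finset.card_shatterer_le_sum_vcDim
    _ ≤ ∑ j ∈ Finset.Iic d, (Fintype.card ι).choose j :=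
        Finset.sum_le_sum_of_subset <| Finset.Iic_subset_Iic.2 <| Finset.sup_le fun A hA =>
          hH A (shatters_of_mem (Finset.mem_shatterer.1 hA))

lemma Shatters.exists_card_eq {F : Set (X → Bool)} {x : ι → X} {A : Finset ι}
    (hA : Shatters (traces F x) A) : ∃ B : Finset X, B.card = A.card ∧ Shatters F B := by
  classical
  have hx : Set.InjOn x A := fun i hi j hj hij => by
    obtain ⟨_, ⟨f, -, rfl⟩, hf⟩ := hA fun m => decide (m = i)
    have hji : decide (j = i) = decide (i = i) :=
      (hf j hj).symm.trans ((congrArg f hij.symm).trans (hf i hi))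
    simpa [eq_comm] using hji
  refine ⟨A.image x, Finset.card_image_of_injOn hx, fun g => ?_⟩
  obtain ⟨_, ⟨f, hf, rfl⟩, hfg⟩ := hA (g ∘ x)
  exact ⟨f, hf, by simpa using hfg⟩

lemma HasVCDim.ncard_traces_le [Fintype ι] {F : Set (X → Bool)} {d : ℕ} (hF : HasVCDim F d)
    (x : ι → X) :
    (traces F x).ncard ≤ ∑ j ∈ Finset.Iic d, (Fintype.card ι).choose j :=
  ncard_le_sum_choose_of_shatters fun _ hA =>
    let ⟨B, hBA, hB⟩ := hA.exists_card_eq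
    hBA ▸ hF.2 ⟨B, rfl, hB⟩

/-- The mistake indicator `(x, y) ↦ [f x ≠ y]` of a classifier, as a classifier of labelled
examples. -/
def loss (f : X → Bool) (z : X × Bool) : Bool := f z.1 ^^ z.2

lemma traces_loss_image (F : Set (X → Bool)) (z : ι → X × Bool) :
    traces (loss '' F) z =
      (fun u i => u i ^^ (z i).2) '' traces F fun i => (z i).1 := by
  simp only [traces, Set.image_image]
  rfl

lemma HasVCDim.ncard_traces_loss_le [Fintype ι] {F : Set (X → Bool)} {d : ℕ}
    (hF : HasVCDim F d) (z : ι → X × Bool) :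
    (traces (loss '' F) z).ncard ≤ ∑ j ∈ Finset.Iic d, (Fintype.card ι).choose j := by
  rw [traces_loss_image]
  exact (Set.ncard_image_le (Set.toFinite _)).trans (hF.ncard_traces_le _)

end Growth

section ExpMoment

variable {Ω Ω' : Type*} {mΩ : MeasurableSpace Ω} {mΩ' : MeasurableSpace Ω'} {μ : Measure Ω}

/-- The exponential moment `E exp Y`. Unlike `ProbabilityTheory.mgf` it is a Lebesgue integral, so
that bounds on it carry no integrability conditions. -/
noncomputable def expMoment (μ : Measure Ω) (Y : Ω → ℝ) : ENNReal :=
  ∫⁻ ω, ENNReal.ofReal (Real.exp (Y ω)) ∂μ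

lemma expMoment_mono {Y Y' : Ω → ℝ} (h : ∀ ω, Y ω ≤ Y' ω) : expMoment μ Y ≤ expMoment μ Y' :=
  lintegral_mono fun ω => ENNReal.ofReal_le_ofReal (Real.exp_le_exp.2 (h ω))

lemma expMoment_const_add (c : ℝ) (Y : Ω → ℝ) :
    expMoment μ (fun ω => c + Y ω) = ENNReal.ofReal (Real.exp c) * expMoment μ Y := by
  simp only [expMoment, Real.exp_add, ENNReal.ofReal_mul (Real.exp_pos c).le]
  exact lintegral_const_mul' _ _ ENNReal.ofReal_ne_top

lemma measurable_ofReal_exp {Y : Ω → ℝ} (hY : Measurable Y) :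
    Measurable fun ω => ENNReal.ofReal (Real.exp (Y ω)) := by
  fun_prop

lemma expMoment_comp {μ' : Measure Ω'} {f : Ω → Ω'} (hf : MeasurePreserving f μ μ') {Y : Ω' → ℝ}
    (hY : Measurable Y) : expMoment μ (fun ω => Y (f ω)) = expMoment μ' Y :=
  hf.lintegral_comp (measurable_ofReal_exp hY)

lemma expMoment_prod (μ' : Measure Ω') [SFinite μ'] {Y : Ω × Ω' → ℝ} (hY : Measurable Y) :
    expMoment (μ.prod μ') Y = ∫⁻ ω, expMoment μ' (fun ω' => Y (ω, ω')) ∂μ :=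
  lintegral_prod _ (measurable_ofReal_exp hY).aemeasurable

lemma expMoment_pi_sum {ι : Type*} [Fintype ι] (P : ι → Measure Ω)
    [∀ i, IsProbabilityMeasure (P i)] {Y : ι → Ω → ℝ} (hY : ∀ i, Measurable (Y i)) :
    expMoment (Measure.pi P) (fun z => ∑ i, Y i (z i)) = ∏ i, expMoment (P i) (Y i) := by
  have hexp (i) := measurable_ofReal_exp (hY i)
  simp only [expMoment, Real.exp_sum,
    ENNReal.ofReal_prod_of_nonneg fun i _ => (Real.exp_pos (Y i _)).le]
  refine (lintegral_prod_eq_prod_lintegral_of_indepFun Finset.univ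
    (fun i (z : ι → Ω) => ENNReal.ofReal (Real.exp (Y i (z i))))
    (iIndepFun_pi fun i => (hexp i).aemeasurable)
    fun i => (hexp i).comp (measurable_pi_apply i)).trans (Finset.prod_congr rfl fun i _ => ?_)
  exact (measurePreserving_eval P i).lintegral_comp (hexp i)

lemma measure_ge_le_mul_expMoment {Y : Ω → ℝ} (hY : Measurable Y) (c : ℝ) :
    μ {ω | c ≤ Y ω} ≤ ENNReal.ofReal (Real.exp (-c)) * expMoment μ Y := by
  rw [← expMoment_const_add]
  calc μ {ω | c ≤ Y ω}
      ≤ μ {ω | 1 ≤ ENNReal.ofReal (Real.exp (-c + Y ω))} := measure_mono fun ω hω => by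
        simpa [neg_add_eq_sub] using hω
    _ ≤ expMoment μ fun ω => -c + Y ω := by
        simpa only [expMoment, one_mul] using
          mul_meas_ge_le_lintegral (measurable_ofReal_exp (hY.const_add (-c))) 1

lemma measurable_toNat {g : Ω → Bool} (hg : Measurable g) :
    Measurable fun ω => ((g ω).toNat : ℝ) :=
  (measurable_of_finite fun b : Bool => (b.toNat : ℝ)).comp hg

lemma expMoment_mul_toNat [IsProbabilityMeasure μ] {g : Ω → Bool} (hg : Measurable g) (l : ℝ) :
    expMoment μ (fun ω => l * (g ω).toNat) =
      ENNReal.ofReal (1 + μ.real {ω | g ω = true} * (Real.exp l - 1)) := by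
  have hs : MeasurableSet {ω | g ω = true} := hg (measurableSet_singleton true)
  have hexp (ω) : Real.exp (l * (g ω).toNat) =
      1 + {ω | g ω = true}.indicator (fun _ => Real.exp l - 1) ω := by
    by_cases h : g ω = true <;> simp [h]
  have hint : Integrable ({ω | g ω = true}.indicator fun _ => Real.exp l - 1) μ :=
    (integrable_const _).indicator hs
  have hint' : Integrable (fun ω => 1 + {ω | g ω = true}.indicator (fun _ => Real.exp l - 1) ω) μ :=
    (integrable_const _).add hint
  have hnonneg (ω) : 0 ≤ 1 + {ω | g ω = true}.indicator (fun _ => Real.exp l - 1) ω :=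
    (Real.exp_pos _).le.trans_eq (hexp ω)
  simp only [expMoment, hexp]
  rw [← ofReal_integral_eq_lintegral_ofReal hint' (ae_of_all _ hnonneg),
    integral_add (integrable_const _) hint, integral_indicator_const _ hs]
  simp

lemma exp_le_expMoment_mul_toNat [IsProbabilityMeasure μ] {g : Ω → Bool} (hg : Measurable g)
    (l : ℝ) : ENNReal.ofReal (Real.exp (l * μ.real {ω | g ω = true})) ≤
      expMoment μ fun ω => l * (g ω).toNat := by
  rw [expMoment_mul_toNat hg]
  refine ENNReal.ofReal_le_ofReal ?_
  have hconv := convexOn_exp.2 (Set.mem_univ (0 : ℝ)) (Set.mem_univ l)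
    (sub_nonneg.2 (measureReal_le_one (μ := μ) (s := {ω | g ω = true}))) measureReal_nonneg
    (sub_add_cancel _ _)
  simp only [smul_eq_mul, mul_zero, zero_add, Real.exp_zero, mul_one] at hconv
  rw [mul_comm l]
  linarith

lemma exp_le_one_add_add_sq {x : ℝ} (hx : |x| ≤ 1) : Real.exp x ≤ 1 + x + x ^ 2 := by
  linarith [(abs_le.1 (Real.abs_exp_sub_one_sub_id_le hx)).2]

lemma expMoment_mul_toNat_le [IsProbabilityMeasure μ] {g : Ω → Bool} (hg : Measurable g) {l : ℝ}
    (hl : |l| ≤ 1) : expMoment μ (fun ω => l * (g ω).toNat) ≤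
      ENNReal.ofReal (Real.exp (μ.real {ω | g ω = true} * (l + l ^ 2))) := by
  rw [expMoment_mul_toNat hg]
  refine ENNReal.ofReal_le_ofReal ?_
  calc 1 + μ.real {ω | g ω = true} * (Real.exp l - 1)
      ≤ μ.real {ω | g ω = true} * (l + l ^ 2) + 1 := by
        nlinarith [exp_le_one_add_add_sq hl,
          measureReal_nonneg (μ := μ) (s := {ω | g ω = true})]
    _ ≤ _ := Real.add_one_le_exp _

end ExpMoment

section Symmetrization

variable {ι W : Type*}

/-- The excess, up to the factor `1 + c`, of the mistake `b` on a ghost example over the mistake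
`a` on the corresponding example of the sample. -/
def pairExcess (c : ℝ) (a b : Bool) : ℝ := b.toNat - (1 + c) * a.toNat

lemma exp_pairExcess_add_exp_pairExcess_le {c l : ℝ} (hl : 0 ≤ l)
    (hlc : l * (1 + (1 + c) ^ 2) ≤ c) (a b : Bool) :
    Real.exp (l * pairExcess c a b) + Real.exp (l * pairExcess c b a) ≤ 2 := by
  have hc : 0 ≤ c := (by positivity : 0 ≤ l * (1 + (1 + c) ^ 2)).trans hlc
  have hlc1 : l * (1 + c) ≤ 1 := by
    by_contra! h
    nlinarith
  have hdiag : Real.exp (-(l * c)) ≤ 1 := Real.exp_le_one_iff.2 (by simpa using mul_nonneg hl hc)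
  have hghost : Real.exp l ≤ 1 + l + l ^ 2 :=
    exp_le_one_add_add_sq (by rw [abs_of_nonneg hl]; nlinarith)
  have hsample : Real.exp (-(l * (1 + c))) ≤ 1 + -(l * (1 + c)) + (-(l * (1 + c))) ^ 2 :=
    exp_le_one_add_add_sq (by rwa [abs_neg, abs_of_nonneg (by positivity)])
  have hsum : l ^ 2 + (l * (1 + c)) ^ 2 ≤ l * c := by
    nlinarith [mul_le_mul_of_nonneg_left hlc hl]
  cases a <;> cases b <;> simp only [pairExcess, Bool.toNat_true, Bool.toNat_false, Nat.cast_one,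
    Nat.cast_zero, mul_zero, mul_one, sub_zero, zero_sub, Real.exp_zero, mul_neg]
  · norm_num
  · linarith
  · linarith
  · rw [show l * (1 - (1 + c)) = -(l * c) by ring]
    linarith

/-- Exchange the pairs selected by `s`. -/
def swapPairs (s : ι → Bool) (q : ι → W × W) (j : ι) : W × W :=
  if s j then (q j).swap else q j

variable [Fintype ι]

/-- The excess, up to the factor `1 + c`, of the mistakes `h` on the ghost sample `(q ·).2` over
those on the sample `(q ·).1`. -/
def ghostExcess (c : ℝ) (h : W → Bool) (q : ι → W × W) : ℝ :=
  ∑ j, pairExcess c (h (q j).1) (h (q j).2)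

lemma ghostExcess_swapPairs (c : ℝ) (h : W → Bool) (s : ι → Bool) (q : ι → W × W) :
    ghostExcess c h (swapPairs s q) =
      ghostExcess c id (swapPairs s fun j => (h (q j).1, h (q j).2)) := by
  refine Finset.sum_congr rfl fun j _ => ?_
  cases hs : s j <;> simp [swapPairs, hs]

variable [DecidableEq ι] {c l : ℝ}

lemma sum_exp_ghostExcess_swapPairs_le (hl : 0 ≤ l) (hlc : l * (1 + (1 + c) ^ 2) ≤ c)
    (u : ι → Bool × Bool) :
    ∑ s : ι → Bool, Real.exp (l * ghostExcess c id (swapPairs s u)) ≤ 2 ^ Fintype.card ι := by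
  let factor (j : ι) (b : Bool) : ℝ :=
    Real.exp (l * if b then pairExcess c (u j).2 (u j).1 else pairExcess c (u j).1 (u j).2)
  calc ∑ s : ι → Bool, Real.exp (l * ghostExcess c id (swapPairs s u))
      = ∑ s : ι → Bool, ∏ j, factor j (s j) := by
        refine Finset.sum_congr rfl fun s _ => ?_
        rw [ghostExcess, Finset.mul_sum, Real.exp_sum]
        refine Finset.prod_congr rfl fun j _ => ?_
        cases hs : s j <;> simp [swapPairs, factor, hs]
    _ = ∏ j, ∑ b, factor j b := by rw [Finset.prod_univ_sum, Fintype.piFinset_univ]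
    _ ≤ ∏ _j : ι, 2 := by
        refine Finset.prod_le_prod (fun _ _ => by positivity) fun j _ => ?_
        rw [Fintype.sum_bool]
        exact exp_pairExcess_add_exp_pairExcess_le hl hlc _ _
    _ = 2 ^ Fintype.card ι := by simp

lemma sum_exp_ghostExcess_swapPairs_le_ncard_traces (hl : 0 ≤ l)
    (hlc : l * (1 + (1 + c) ^ 2) ≤ c) {H : Set (W → Bool)} {h : (ι → Bool) → W → Bool}
    (hH : ∀ s, h s ∈ H) (q : ι → W × W) :
    ∑ s, Real.exp (l * ghostExcess c (h s) (swapPairs s q)) ≤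
      (traces H (Sum.elim (fun j => (q j).1) fun j => (q j).2)).ncard * 2 ^ Fintype.card ι := by
  classical
  let points : ι ⊕ ι → W := Sum.elim (fun j => (q j).1) fun j => (q j).2
  obtain ⟨T, hT⟩ := (Set.toFinite (traces H points)).exists_finset_coe
  let labelExcess (s : ι → Bool) (v : ι ⊕ ι → Bool) : ℝ :=
    ghostExcess c id (swapPairs s fun j => (v (Sum.inl j), v (Sum.inr j)))
  have hlabel (s : ι → Bool) :
      ghostExcess c (h s) (swapPairs s q) = labelExcess s (h s ∘ points) :=
    ghostExcess_swapPairs c (h s) s q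
  have hmem (s : ι → Bool) : h s ∘ points ∈ T := by
    rw [← Finset.mem_coe, hT]
    exact Set.mem_image_of_mem _ (hH s)
  calc ∑ s, Real.exp (l * ghostExcess c (h s) (swapPairs s q))
      ≤ ∑ s, ∑ v ∈ T, Real.exp (l * labelExcess s v) := by
        refine Finset.sum_le_sum fun s _ => ?_
        rw [hlabel]
        exact Finset.single_le_sum (f := fun v => Real.exp (l * labelExcess s v))
          (fun _ _ => (Real.exp_pos _).le) (hmem s)
    _ = ∑ v ∈ T, ∑ s, Real.exp (l * labelExcess s v) := Finset.sum_comm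
    _ ≤ ∑ _v ∈ T, 2 ^ Fintype.card ι :=
        Finset.sum_le_sum fun v _ => sum_exp_ghostExcess_swapPairs_le hl hlc _
    _ = (traces H points).ncard * 2 ^ Fintype.card ι := by simp [← hT]

end Symmetrization

section GhostSample

variable {ι Z : Type*} [Fintype ι] [MeasurableSpace Z] {P : Measure Z} {g : (ι → Z) → Z → Bool}
  {c l : ℝ}

lemma measurePreserving_swapPairs [SigmaFinite P] (s : ι → Bool) :
    MeasurePreserving (swapPairs s)
      (Measure.pi fun _ : ι => P.prod P) (Measure.pi fun _ : ι => P.prod P) := by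
  refine measurePreserving_pi (fun _ => P.prod P) (fun _ => P.prod P)
    (f := fun j z => if s j then z.swap else z) fun j => ?_
  cases s j
  · exact MeasurePreserving.id _
  · exact Measure.measurePreserving_swap

lemma measurable_ghostExcess (hg : Measurable fun p : (ι → Z) × Z => g p.1 p.2) (c : ℝ) :
    Measurable fun q : ι → Z × Z => ghostExcess c (g fun i => (q i).1) q := by
  refine Finset.measurable_fun_sum _ fun j _ =>
    (measurable_of_finite fun p : Bool × Bool => pairExcess c p.1 p.2).comp (.prodMk ?_ ?_)
  · exact hg.comp (by fun_prop : Measurable fun q : ι → Z × Z => ((fun i => (q i).1), (q j).1))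
  · exact hg.comp (by fun_prop : Measurable fun q : ι → Z × Z => ((fun i => (q i).1), (q j).2))

variable [IsProbabilityMeasure P]

lemma exp_excess_le_expMoment_ghostExcess {h : Z → Bool} (hh : Measurable h) (c l : ℝ)
    (S : ι → Z) :
    ENNReal.ofReal (Real.exp
        (l * (Fintype.card ι * P.real {z | h z = true} - (1 + c) * ∑ j, (h (S j)).toNat))) ≤
      expMoment (Measure.pi fun _ : ι => P) fun S' => l * ghostExcess c h fun j => (S j, S' j) := by
  have hsplit (S' : ι → Z) : l * ghostExcess c h (fun j => (S j, S' j)) =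
      -(l * ((1 + c) * ∑ j, (h (S j)).toNat)) + ∑ j, l * (h (S' j)).toNat := by
    simp only [ghostExcess, pairExcess, Finset.sum_sub_distrib, ← Finset.mul_sum, Nat.cast_sum]
    ring
  simp only [hsplit]
  rw [expMoment_const_add,
    expMoment_pi_sum (fun _ => P) fun _ : ι => (measurable_toNat hh).const_mul l,
    Finset.prod_const, Finset.card_univ,
    show l * (Fintype.card ι * P.real {z | h z = true} - (1 + c) * ∑ j, (h (S j)).toNat) =
      -(l * ((1 + c) * ∑ j, (h (S j)).toNat)) + Fintype.card ι * (l * P.real {z | h z = true}) by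
        ring,
    Real.exp_add, Real.exp_nat_mul, ENNReal.ofReal_mul (Real.exp_pos _).le,
    ENNReal.ofReal_pow (Real.exp_pos _).le]
  gcongr
  exact exp_le_expMoment_mul_toNat hh l

lemma expMoment_excess_le_expMoment_ghostExcess
    (hg : Measurable fun p : (ι → Z) × Z => g p.1 p.2) (c l : ℝ) :
    expMoment (Measure.pi fun _ : ι => P) (fun S =>
        l * (Fintype.card ι * P.real {z | g S z = true} - (1 + c) * ∑ j, (g S (S j)).toNat)) ≤
      expMoment (Measure.pi fun _ : ι => P.prod P) fun q =>
        l * ghostExcess c (g fun i => (q i).1) q := by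
  have hmeas : Measurable fun q : (ι → Z) × (ι → Z) =>
      l * ghostExcess c (g q.1) fun j => (q.1 j, q.2 j) :=
    ((measurable_ghostExcess hg c).comp
      (MeasurableEquiv.arrowProdEquivProdArrow Z Z ι).symm.measurable).const_mul l
  calc _ ≤ ∫⁻ S, expMoment (Measure.pi fun _ : ι => P)
          (fun S' => l * ghostExcess c (g S) fun j => (S j, S' j)) ∂Measure.pi fun _ : ι => P :=
        lintegral_mono fun S => exp_excess_le_expMoment_ghostExcess
          (hg.comp measurable_prodMk_left) c l S
    _ = expMoment ((Measure.pi fun _ : ι => P).prod (Measure.pi fun _ : ι => P)) fun q =>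
          l * ghostExcess c (g q.1) fun j => (q.1 j, q.2 j) := (expMoment_prod _ hmeas).symm
    _ = expMoment (Measure.pi fun _ : ι => P.prod P) fun q =>
          l * ghostExcess c (g fun i => (q i).1) q :=
        (expMoment_comp (measurePreserving_arrowProdEquivProdArrow Z Z ι (fun _ => P) fun _ => P)
          hmeas).symm

theorem expMoment_excess_le {N : ℕ} {H : Set (Z → Bool)}
    (hN : ∀ q : ι ⊕ ι → Z, (traces H q).ncard ≤ N)
    (hg : Measurable fun p : (ι → Z) × Z => g p.1 p.2) (hgH : ∀ S, g S ∈ H)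
    (hl : 0 ≤ l) (hlc : l * (1 + (1 + c) ^ 2) ≤ c) :
    expMoment (Measure.pi fun _ : ι => P) (fun S =>
      l * (Fintype.card ι * P.real {z | g S z = true} - (1 + c) * ∑ j, (g S (S j)).toNat)) ≤
      N := by
  classical
  refine (expMoment_excess_le_expMoment_ghostExcess hg c l).trans ?_
  set μ := Measure.pi fun _ : ι => P.prod P
  let G (q : ι → Z × Z) : ℝ := l * ghostExcess c (g fun i => (q i).1) q
  have hG : Measurable G := (measurable_ghostExcess hg c).const_mul l
  have hpoint (q : ι → Z × Z) : ∑ s, ENNReal.ofReal (Real.exp (G (swapPairs s q))) ≤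
      2 ^ Fintype.card ι * N := by
    rw [← ENNReal.ofReal_sum_of_nonneg fun _ _ => (Real.exp_pos _).le]
    refine ENNReal.ofReal_le_of_le_toReal ((sum_exp_ghostExcess_swapPairs_le_ncard_traces hl hlc
      (fun s => hgH fun i => (swapPairs s q i).1) q).trans ?_)
    simp only [ENNReal.toReal_mul, ENNReal.toReal_pow, ENNReal.toReal_ofNat, ENNReal.toReal_natCast]
    rw [mul_comm]
    gcongr
    exact hN _
  have haverage : 2 ^ Fintype.card ι * expMoment μ G ≤ 2 ^ Fintype.card ι * N := by
    calc 2 ^ Fintype.card ι * expMoment μ G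
        = ∑ s : ι → Bool, expMoment μ fun q => G (swapPairs s q) := by
          simp [expMoment_comp (measurePreserving_swapPairs (P := P) _) hG, μ]
      _ = ∫⁻ q, ∑ s : ι → Bool, ENNReal.ofReal (Real.exp (G (swapPairs s q))) ∂μ :=
          (lintegral_finsetSum _ fun s _ => (measurable_ofReal_exp hG).comp
            (measurePreserving_swapPairs (P := P) s).measurable).symm
      _ ≤ ∫⁻ _q, 2 ^ Fintype.card ι * N ∂μ := lintegral_mono hpoint
      _ = 2 ^ Fintype.card ι * N := by simp [μ]
  exact (ENNReal.mul_le_mul_iff_right (by simp) (by simp)).1 haverage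

end GhostSample

section EmpiricalError

variable {X : Type*} {n : ℕ}

lemma loss_eq_true {f : X → Bool} {z : X × Bool} : loss f z = true ↔ f z.1 ≠ z.2 := by
  simp [loss]

lemma empErr_eq_sum_loss_div (S : Fin n → X × Bool) (f : X → Bool) :
    empErr S f = (∑ j, ((loss f (S j)).toNat : ℝ)) / n := by
  rw [empErr, Finset.card_filter, Nat.cast_sum]
  congr! 3 with j
  cases hf : f (S j).1 <;> cases hS : (S j).2 <;> simp [loss, hf, hS]

lemma natCast_mul_empErr (S : Fin n → X × Bool) (f : X → Bool) :
    n * empErr S f = ∑ j, ((loss f (S j)).toNat : ℝ) := by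
  rw [empErr_eq_sum_loss_div]
  obtain rfl | hn := eq_or_ne n 0
  · simp
  · exact mul_div_cancel₀ _ (Nat.cast_ne_zero.2 hn)

lemma empErr_nonneg (S : Fin n → X × Bool) (f : X → Bool) : 0 ≤ empErr S f := by
  rw [empErr]
  positivity

lemma empErr_le_one (S : Fin n → X × Bool) (f : X → Bool) : empErr S f ≤ 1 :=
  div_le_one_of_le₀ (Nat.cast_le.2 ((Finset.card_filter_le _ _).trans_eq (by simp)))
    (Nat.cast_nonneg n)

variable [MeasurableSpace X]

lemma err_nonneg (D : Measure (X × Bool)) (f : X → Bool) : 0 ≤ err D f := measureReal_nonneg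

lemma err_eq_measureReal_loss (D : Measure (X × Bool)) (f : X → Bool) :
    err D f = D.real {z | loss f z = true} := by
  simp only [err, loss_eq_true]

section Measurability

variable {A : Type*} [MeasurableSpace A] {O : A → X → Bool}

lemma measurable_loss_comp (hO : Measurable fun p : A × X => O p.1 p.2) :
    Measurable fun p : A × (X × Bool) => loss (O p.1) p.2 :=
  (measurable_of_finite fun p : Bool × Bool => p.1 ^^ p.2).comp
    ((hO.comp (measurable_fst.prodMk (measurable_fst.comp measurable_snd))).prodMk
      (measurable_snd.comp measurable_snd))

lemma measurable_loss {f : X → Bool} (hf : Measurable f) : Measurable (loss f) :=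
  (measurable_loss_comp (O := fun _ : Unit => f) (hf.comp measurable_snd)).comp
    (measurable_prodMk_left (x := ()))

lemma measurable_err_comp (hO : Measurable fun p : A × X => O p.1 p.2) (D : Measure (X × Bool))
    [SFinite D] : Measurable fun p => err D (O p) := by
  simp only [err_eq_measureReal_loss]
  have hs : MeasurableSet {p : A × (X × Bool) | loss (O p.1) p.2 = true} :=
    measurable_loss_comp hO (measurableSet_singleton true)
  exact (measurable_measure_prodMk_left hs).ennreal_toReal

lemma measurable_empErr_comp (hO : Measurable fun p : A × X => O p.1 p.2)
    {S : A → Fin n → X × Bool} (hS : Measurable S) :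
    Measurable fun p => empErr (S p) (O p) := by
  simp only [empErr_eq_sum_loss_div]
  exact (Finset.measurable_fun_sum _ fun j _ => measurable_toNat <| (measurable_loss_comp hO).comp
    (measurable_id.prodMk ((measurable_pi_apply j).comp hS))).div_const _

end Measurability

theorem measure_err_gt_le {F : Set (X → Bool)} {d : ℕ} (hF : HasVCDim F d) {a e : ℝ} (ha : 0 < a)
    (ha1 : a ≤ 1) (he : 0 < e) (he1 : e ≤ 1) (P : Measure (X × Bool)) [IsProbabilityMeasure P]
    {O : (Fin n → X × Bool) → X → Bool}
    (hO : Measurable fun p : (Fin n → X × Bool) × X => O p.1 p.2) (hOF : ∀ S, O S ∈ F) :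
    (Measure.pi fun _ : Fin n => P) {S | (1 + a) * empErr S (O S) + e < err P (O S)} ≤
      ENNReal.ofReal ((24 / (a * e)) ^ d * Real.exp (-(a * e / 12 * n))) := by
  have hcoeff : a / 6 * (1 + (1 + a) ^ 2) ≤ a := by
    nlinarith [mul_nonneg ha.le (by nlinarith : 0 ≤ 4 - (1 + a) ^ 2)]
  let excess (S : Fin n → X × Bool) : ℝ :=
    a / 6 * (n * err P (O S) - (1 + a) * (n * empErr S (O S)))
  have hexcess : Measurable excess :=
    (((measurable_err_comp hO P).const_mul _).sub
      (((measurable_empErr_comp hO measurable_id).const_mul _).const_mul _)).const_mul _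
  have hmoment : expMoment (Measure.pi fun _ => P) excess ≤
      ((∑ j ∈ Finset.Iic d, (n + n).choose j : ℕ) : ENNReal) := by
    simp only [excess, natCast_mul_empErr, err_eq_measureReal_loss]
    simpa using expMoment_excess_le (c := a) (l := a / 6) (fun q => hF.ncard_traces_loss_le q)
      (measurable_loss_comp hO) (fun S => Set.mem_image_of_mem loss (hOF S)) (by positivity)
      hcoeff
  have hgrowth : (∑ j ∈ Finset.Iic d, (n + n).choose j : ℕ) ≤
      (24 / (a * e)) ^ d * Real.exp (a * e / 12 * n) := by
    convert sum_choose_le (n + n) d (x := a * e / 24) (by positivity) (by nlinarith) using 3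
    · simp
    · field_simp
    · push_cast
      ring
  calc (Measure.pi fun _ : Fin n => P) {S | (1 + a) * empErr S (O S) + e < err P (O S)}
      ≤ (Measure.pi fun _ : Fin n => P) {S | a * e / 6 * n ≤ excess S} :=
        measure_mono fun S hS => by
          have := mul_le_mul_of_nonneg_left hS.le (by positivity : 0 ≤ a / 6 * n)
          simp only [Set.mem_ofPred_eq, excess]
          linarith
    _ ≤ ENNReal.ofReal (Real.exp (-(a * e / 6 * n))) *
          ENNReal.ofReal ((24 / (a * e)) ^ d * Real.exp (a * e / 12 * n)) := by
        refine (measure_ge_le_mul_expMoment hexcess _).trans (mul_le_mul_right (hmoment.trans ?_) _)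
        rw [← ENNReal.ofReal_natCast]
        exact ENNReal.ofReal_le_ofReal hgrowth
    _ = ENNReal.ofReal ((24 / (a * e)) ^ d * Real.exp (-(a * e / 12 * n))) := by
        rw [← ENNReal.ofReal_mul (Real.exp_pos _).le, mul_left_comm, ← Real.exp_add]
        ring_nf

theorem expMoment_mul_empErr_le {P : Measure (X × Bool)} [IsProbabilityMeasure P] {f : X → Bool}
    (hf : Measurable f) {l : ℝ} (hl : |l| ≤ 1) :
    expMoment (Measure.pi fun _ : Fin n => P) (fun S => l * (n * empErr S f)) ≤
      ENNReal.ofReal (Real.exp (n * (err P f * (l + l ^ 2)))) := by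
  simp only [natCast_mul_empErr, Finset.mul_sum]
  rw [expMoment_pi_sum (fun _ => P)
      fun _ : Fin n => (measurable_toNat (measurable_loss hf)).const_mul l,
    Finset.prod_const, Finset.card_univ, Fintype.card_fin, Real.exp_nat_mul,
    ENNReal.ofReal_pow (Real.exp_pos _).le, err_eq_measureReal_loss]
  gcongr
  exact expMoment_mul_toNat_le (measurable_loss hf) hl

theorem measure_empErr_gt_le {a : ℝ} (ha : 0 ≤ a) (ha1 : a ≤ 1) (e : ℝ) (P : Measure (X × Bool))
    [IsProbabilityMeasure P] {f : X → Bool} (hf : Measurable f) :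
    (Measure.pi fun _ : Fin n => P) {S | (1 + a) * err P f + e < empErr S f} ≤
      ENNReal.ofReal (Real.exp (-(a * e * n))) := by
  have hmeas : Measurable fun S : Fin n → X × Bool => a * (n * empErr S f) :=
    ((measurable_empErr_comp (O := fun _ => f) (hf.comp measurable_snd)
      measurable_id).const_mul _).const_mul _
  set c := a * n * ((1 + a) * err P f + e) with hc
  calc (Measure.pi fun _ : Fin n => P) {S | (1 + a) * err P f + e < empErr S f}
      ≤ (Measure.pi fun _ : Fin n => P) {S | c ≤ a * (n * empErr S f)} :=
        measure_mono fun S hS => by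
          simpa only [Set.mem_ofPred_eq, hc, mul_assoc] using
            mul_le_mul_of_nonneg_left (le_of_lt hS) (by positivity : 0 ≤ a * n)
    _ ≤ ENNReal.ofReal (Real.exp (-c)) *
          ENNReal.ofReal (Real.exp (n * (err P f * (a + a ^ 2)))) :=
        (measure_ge_le_mul_expMoment hmeas c).trans
          (mul_le_mul_right (expMoment_mul_empErr_le hf (by rwa [abs_of_nonneg ha])) _)
    _ = ENNReal.ofReal (Real.exp (-(a * e * n))) := by
        rw [← ENNReal.ofReal_mul (Real.exp_pos _).le, ← Real.exp_add, hc]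
        ring_nf

theorem expMoment_sum_mul_empErr_le {ι : Type*} [Fintype ι] {D : ι → Measure (X × Bool)}
    [∀ i, IsProbabilityMeasure (D i)] {f : X → Bool} (hf : Measurable f) {b : ι → ℝ}
    (hb : ∀ i, |b i| ≤ 1) :
    expMoment (Measure.pi fun i => Measure.pi fun _ : Fin n => D i)
        (fun T => ∑ i, b i * (n * empErr (T i) f)) ≤
      ENNReal.ofReal (Real.exp (n * ∑ i, err (D i) f * (b i + b i ^ 2))) := by
  have hmeas (i) : Measurable fun S : Fin n → X × Bool => b i * (n * empErr S f) :=
    ((measurable_empErr_comp (O := fun _ => f) (hf.comp measurable_snd)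
      measurable_id).const_mul _).const_mul _
  rw [expMoment_pi_sum (fun i => Measure.pi fun _ : Fin n => D i) hmeas, Finset.mul_sum,
    Real.exp_sum, ENNReal.ofReal_prod_of_nonneg fun _ _ => (Real.exp_pos _).le]
  exact Finset.prod_le_prod' fun i _ => expMoment_mul_empErr_le hf (hb i)

end EmpiricalError

section Mixture

variable {X : Type*} [MeasurableSpace X] {k : ℕ} {D : Fin k → Measure (X × Bool)} {w : Fin k → ℝ}

lemma isProbabilityMeasure_mixture [NeZero k] [∀ i, IsProbabilityMeasure (D i)]
    (hw : ∀ i, 0 < w i) : IsProbabilityMeasure (mixture D w) := by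
  have hpos : 0 < ∑ j, w j := Finset.sum_pos (fun i _ => hw i) Finset.univ_nonempty
  constructor
  simp only [mixture, Measure.coe_finsetSum, Finset.sum_apply, Measure.smul_apply, measure_univ,
    smul_eq_mul, mul_one]
  rw [← ENNReal.ofReal_sum_of_nonneg fun i _ => (div_pos (hw i) hpos).le, ← Finset.sum_div,
    div_self hpos.ne', ENNReal.ofReal_one]

lemma err_mixture [∀ i, IsFiniteMeasure (D i)] (hw : ∀ i, 0 ≤ w i) (f : X → Bool) :
    err (mixture D w) f = ∑ i, w i / (∑ j, w j) * err (D i) f := by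
  simp only [err, Measure.real, mixture, Measure.coe_finsetSum, Finset.sum_apply,
    Measure.smul_apply, smul_eq_mul]
  rw [ENNReal.toReal_sum fun i _ => ENNReal.mul_ne_top ENNReal.ofReal_ne_top (measure_ne_top _ _)]
  refine Finset.sum_congr rfl fun i _ => ?_
  rw [ENNReal.toReal_mul,
    ENNReal.toReal_ofReal (div_nonneg (hw i) (Finset.sum_nonneg fun j _ => hw j))]

lemma err_mixture_le [NeZero k] [∀ i, IsFiniteMeasure (D i)] (hw : ∀ i, 0 < w i) {f : X → Bool}
    {B : ℝ} (hB : ∀ i, err (D i) f ≤ B) : err (mixture D w) f ≤ B := by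
  have hpos : 0 < ∑ j, w j := Finset.sum_pos (fun i _ => hw i) Finset.univ_nonempty
  rw [err_mixture fun i => (hw i).le]
  calc ∑ i, w i / (∑ j, w j) * err (D i) f ≤ ∑ i, w i / (∑ j, w j) * B :=
        Finset.sum_le_sum fun i _ =>
          mul_le_mul_of_nonneg_left (hB i) (div_pos (hw i) hpos).le
    _ = B := by rw [← Finset.sum_mul, ← Finset.sum_div, div_self hpos.ne', one_mul]

end Mixture

section AdaptiveSampling

variable {Z : Type*} {r : ℕ}

lemma measurable_snoc [MeasurableSpace Z] :
    Measurable fun p : (Fin r → Z) × Z => (Fin.snoc (α := fun _ => Z) p.1 p.2 : Fin (r + 1) → Z) :=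
  measurable_pi_lambda _ <| Fin.lastCases (by simpa using measurable_snd) fun j => by
    simp only [Fin.snoc_castSucc]
    exact (measurable_pi_apply j).comp measurable_fst

/-- Every draw `z` of the history, made after the history `h`, satisfies `good r h z`. -/
def AllGood (good : (r : ℕ) → (Fin r → Z) → Z → Prop) : (r : ℕ) → (Fin r → Z) → Prop
  | 0, _ => True
  | r + 1, h => AllGood good r (Fin.init h) ∧ good r (Fin.init h) (h (Fin.last r))

variable {good : (r : ℕ) → (Fin r → Z) → Z → Prop}

lemma allGood_snoc {h : Fin r → Z} {z : Z} :
    AllGood good (r + 1) (Fin.snoc (α := fun _ => Z) h z) ↔ AllGood good r h ∧ good r h z := by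
  simp [AllGood]

lemma AllGood.forall {p : Z → Prop} (hp : ∀ r h z, good r h z → p z) {h : Fin r → Z}
    (hh : AllGood good r h) (j : Fin r) : p (h j) := by
  induction r with
  | zero => exact j.elim0
  | succ r ih => exact Fin.lastCases (hp _ _ _ hh.2) (fun j => ih (h := Fin.init h) hh.1 j) j

variable [MeasurableSpace Z]

lemma measurableSet_allGood
    (hgood : ∀ r, MeasurableSet {p : (Fin r → Z) × Z | good r p.1 p.2}) (r : ℕ) :
    MeasurableSet {h : Fin r → Z | AllGood good r h} := by
  induction r with
  | zero => simp [AllGood]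
  | succ r ih =>
    have hinit : Measurable fun h : Fin (r + 1) → Z => (Fin.init h : Fin r → Z) :=
      measurable_pi_lambda _ fun _ => measurable_pi_apply _
    exact (hinit ih).inter ((hinit.prodMk (measurable_pi_apply (Fin.last r))) (hgood r))

/-- The joint law of `r` successive draws, where a draw after the history `h` has law `κ r h`.
This is `ProbabilityTheory.Kernel.partialTraj` for histories indexed by `Fin r`. -/
noncomputable def adaptiveLaw (κ : (r : ℕ) → Kernel (Fin r → Z) Z) :
    (r : ℕ) → Measure (Fin r → Z)
  | 0 => Measure.dirac Fin.elim0
  | r + 1 => (adaptiveLaw κ r ⊗ₘ κ r).map fun p => Fin.snoc (α := fun _ => Z) p.1 p.2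

variable {κ : (r : ℕ) → Kernel (Fin r → Z) Z} [∀ r, IsMarkovKernel (κ r)]

instance isProbabilityMeasure_adaptiveLaw (r : ℕ) : IsProbabilityMeasure (adaptiveLaw κ r) := by
  induction r with
  | zero => exact Measure.dirac.isProbabilityMeasure
  | succ r ih => exact Measure.isProbabilityMeasure_map measurable_snoc.aemeasurable

lemma lintegral_adaptiveLaw_succ {J : (Fin (r + 1) → Z) → ENNReal} (hJ : Measurable J) :
    ∫⁻ h, J h ∂adaptiveLaw κ (r + 1) =
      ∫⁻ h, ∫⁻ z, J (Fin.snoc (α := fun _ => Z) h z) ∂κ r h ∂adaptiveLaw κ r := by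
  rw [adaptiveLaw, lintegral_map hJ measurable_snoc]
  exact Measure.lintegral_compProd (hJ.comp measurable_snoc)

lemma lintegral_adaptiveLaw_le {J : (r : ℕ) → (Fin r → Z) → ENNReal} (hJ : ∀ r, Measurable (J r))
    {β : ENNReal}
    (hdrift : ∀ r h, ∫⁻ z, J (r + 1) (Fin.snoc (α := fun _ => Z) h z) ∂κ r h ≤ J r h + β) (r : ℕ) :
    ∫⁻ h, J r h ∂adaptiveLaw κ r ≤ J 0 Fin.elim0 + r * β := by
  induction r with
  | zero => simp [adaptiveLaw, lintegral_dirac' _ (hJ 0)]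
  | succ r ih =>
    calc ∫⁻ h, J (r + 1) h ∂adaptiveLaw κ (r + 1)
        ≤ ∫⁻ h, (J r h + β) ∂adaptiveLaw κ r := by
          rw [lintegral_adaptiveLaw_succ (hJ (r + 1))]
          exact lintegral_mono (hdrift r)
      _ = ∫⁻ h, J r h ∂adaptiveLaw κ r + β := by
          rw [lintegral_add_right _ measurable_const, lintegral_const, measure_univ, mul_one]
      _ ≤ J 0 Fin.elim0 + (r + 1 : ℕ) * β := by
          push_cast
          rw [add_mul, one_mul, ← add_assoc]
          gcongr

lemma adaptiveLaw_not_allGood_le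
    (hgood : ∀ r, MeasurableSet {p : (Fin r → Z) × Z | good r p.1 p.2}) {β : ENNReal}
    (hβ : ∀ r h, κ r h {z | ¬ good r h z} ≤ β) (r : ℕ) :
    adaptiveLaw κ r {h | ¬ AllGood good r h} ≤ r * β := by
  have hbad (r : ℕ) : MeasurableSet {h : Fin r → Z | ¬ AllGood good r h} :=
    (measurableSet_allGood hgood r).compl
  have hdrift (r : ℕ) (h : Fin r → Z) :
      ∫⁻ z, {h | ¬ AllGood good (r + 1) h}.indicator 1 (Fin.snoc (α := fun _ => Z) h z) ∂κ r h ≤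
        {h | ¬ AllGood good r h}.indicator (1 : (Fin r → Z) → ENNReal) h + β := by
    have hbad_z : MeasurableSet {z | ¬ good r h z} := (measurable_prodMk_left (hgood r)).compl
    calc _ ≤ ∫⁻ z, ({h | ¬ AllGood good r h}.indicator (1 : (Fin r → Z) → ENNReal) h +
          {z | ¬ good r h z}.indicator 1 z) ∂κ r h := by
          refine lintegral_mono fun z => ?_
          by_cases hh : AllGood good r h <;> by_cases hz : good r h z <;>
            simp [Set.indicator, allGood_snoc, hh, hz]
      _ = {h | ¬ AllGood good r h}.indicator 1 h + κ r h {z | ¬ good r h z} := by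
          rw [lintegral_add_left measurable_const, lintegral_const, measure_univ, mul_one,
            lintegral_indicator_one hbad_z]
      _ ≤ _ := by
          gcongr
          exact hβ r h
  have hle := lintegral_adaptiveLaw_le (fun r => measurable_one.indicator (hbad r)) hdrift r
  simpa [lintegral_indicator_one (hbad r), AllGood] using hle

variable {Φ : (r : ℕ) → (Fin r → Z) → ℝ}

lemma expMoment_adaptiveLaw_restrict_le
    (hgood : ∀ r, MeasurableSet {p : (Fin r → Z) × Z | good r p.1 p.2})
    (hΦ : ∀ r, Measurable (Φ r))
    (hsuper : ∀ r h, expMoment ((κ r h).restrict {z | good r h z})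
      (fun z => Φ (r + 1) (Fin.snoc (α := fun _ => Z) h z)) ≤
        ENNReal.ofReal (Real.exp (Φ r h))) (r : ℕ) :
    expMoment ((adaptiveLaw κ r).restrict {h | AllGood good r h}) (Φ r) ≤
      ENNReal.ofReal (Real.exp (Φ 0 Fin.elim0)) := by
  let J (r : ℕ) : (Fin r → Z) → ENNReal :=
    {h | AllGood good r h}.indicator fun h => ENNReal.ofReal (Real.exp (Φ r h))
  have hJ (r : ℕ) : Measurable (J r) :=
    (measurable_ofReal_exp (hΦ r)).indicator (measurableSet_allGood hgood r)
  have hdrift (r : ℕ) (h : Fin r → Z) :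
      ∫⁻ z, J (r + 1) (Fin.snoc (α := fun _ => Z) h z) ∂κ r h ≤ J r h + 0 := by
    by_cases hh : AllGood good r h
    · have hgood_z : MeasurableSet {z | good r h z} := measurable_prodMk_left (hgood r)
      have hJ_snoc (z : Z) : J (r + 1) (Fin.snoc (α := fun _ => Z) h z) =
          {z | good r h z}.indicator (fun z => ENNReal.ofReal
            (Real.exp (Φ (r + 1) (Fin.snoc (α := fun _ => Z) h z)))) z := by
        by_cases hz : good r h z <;> simp [J, Set.indicator, allGood_snoc, hh, hz]
      simp only [hJ_snoc, lintegral_indicator hgood_z]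
      simpa [J, hh, expMoment] using hsuper r h
    · simp [J, allGood_snoc, hh]
  have hle := lintegral_adaptiveLaw_le hJ hdrift r
  simpa [J, expMoment, lintegral_indicator (measurableSet_allGood hgood r), AllGood] using hle

lemma adaptiveLaw_allGood_and_ge_le
    (hgood : ∀ r, MeasurableSet {p : (Fin r → Z) × Z | good r p.1 p.2})
    (hΦ : ∀ r, Measurable (Φ r))
    (hsuper : ∀ r h, expMoment ((κ r h).restrict {z | good r h z})
      (fun z => Φ (r + 1) (Fin.snoc (α := fun _ => Z) h z)) ≤
        ENNReal.ofReal (Real.exp (Φ r h))) (r : ℕ) (c : ℝ) :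
    adaptiveLaw κ r {h | AllGood good r h ∧ Φ 0 Fin.elim0 + c ≤ Φ r h} ≤
      ENNReal.ofReal (Real.exp (-c)) := by
  have hmarkov := (measure_ge_le_mul_expMoment (hΦ r) (Φ 0 Fin.elim0 + c)).trans
    (mul_le_mul_right (expMoment_adaptiveLaw_restrict_le hgood hΦ hsuper r) _)
  rw [Measure.restrict_apply (measurableSet_le measurable_const (hΦ r)),
    ← ENNReal.ofReal_mul (Real.exp_pos _).le, ← Real.exp_add, Set.inter_comm,
    show -(Φ 0 Fin.elim0 + c) + Φ 0 Fin.elim0 = -c by ring] at hmarkov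
  exact hmarkov

theorem le_adaptiveLaw_allGood_and_forall_lt {ι : Type*} [Fintype ι]
    {Φ : ι → (r : ℕ) → (Fin r → Z) → ℝ}
    (hgood : ∀ r, MeasurableSet {p : (Fin r → Z) × Z | good r p.1 p.2}) {β : ENNReal}
    (hβ : ∀ r h, κ r h {z | ¬ good r h z} ≤ β) (hΦ : ∀ i r, Measurable (Φ i r))
    (hsuper : ∀ i r h, expMoment ((κ r h).restrict {z | good r h z})
      (fun z => Φ i (r + 1) (Fin.snoc (α := fun _ => Z) h z)) ≤
        ENNReal.ofReal (Real.exp (Φ i r h))) (r : ℕ) (c : ℝ) :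
    1 - (r * β + Fintype.card ι * ENNReal.ofReal (Real.exp (-c))) ≤
      adaptiveLaw κ r {h | AllGood good r h ∧ ∀ i, Φ i r h < Φ i 0 Fin.elim0 + c} := by
  set success := {h | AllGood good r h ∧ ∀ i, Φ i r h < Φ i 0 Fin.elim0 + c}
  have hfailure : successᶜ ⊆ {h | ¬ AllGood good r h} ∪
      ⋃ i, {h | AllGood good r h ∧ Φ i 0 Fin.elim0 + c ≤ Φ i r h} := fun h hh => by
    by_cases hallGood : AllGood good r h
    · obtain ⟨i, hi⟩ := not_forall.1 fun hlt => hh ⟨hallGood, hlt⟩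
      exact .inr (Set.mem_iUnion.2 ⟨i, hallGood, not_lt.1 hi⟩)
    · exact .inl hallGood
  refine tsub_le_iff_right.2 ?_
  calc 1 ≤ adaptiveLaw κ r success + adaptiveLaw κ r successᶜ :=
        measure_univ.symm.trans_le (measure_univ_le_add_compl _)
    _ ≤ adaptiveLaw κ r success + (r * β + ∑ _i : ι, ENNReal.ofReal (Real.exp (-c))) := by
        gcongr
        refine (measure_mono hfailure).trans ((measure_union_le _ _).trans (add_le_add
          (adaptiveLaw_not_allGood_le hgood hβ r) ((measure_iUnion_fintype_le _ _).trans ?_)))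
        exact Finset.sum_le_sum fun i _ =>
          adaptiveLaw_allGood_and_ge_le hgood (hΦ i) (hsuper i) r c
    _ = adaptiveLaw κ r success + (r * β + Fintype.card ι * ENNReal.ofReal (Real.exp (-c))) := by
        simp

end AdaptiveSampling

section Algorithm

variable {X : Type*} {k mS mT : ℕ} {ε α : ℝ} {O : (Fin mS → X × Bool) → X → Bool}

lemma eps'_pos (hε : 0 < ε) : 0 < eps' ε := div_pos hε (by norm_num)

lemma alpha'_pos (hα : 0 < α) : 0 < alpha' α := div_pos hα (by norm_num)

lemma step_nonneg (hε : 0 < ε) (hα : 0 < α) (z : Round X k mS mT) (i : Fin k) :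
    0 ≤ step ε α O z i := by
  have hT := empErr_nonneg (z.2 i) (O z.1)
  have hS := empErr_nonneg z.1 (O z.1)
  have he := eps'_pos hε
  have ha := alpha'_pos hα
  rw [step]
  positivity

lemma weights_pos (hε : 0 < ε) (hα : 0 < α) (r : ℕ) (h : Fin r → Round X k mS mT) (i : Fin k) :
    0 < weights ε α O r h i := by
  induction r with
  | zero => exact one_pos
  | succ r ih => exact mul_pos (ih _) (by linarith [step_nonneg (O := O) hε hα (h (Fin.last r)) i])

lemma weights_snoc {r : ℕ} (h : Fin r → Round X k mS mT) (z : Round X k mS mT) (i : Fin k) :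
    weights ε α O (r + 1) (Fin.snoc (α := fun _ => Round X k mS mT) h z) i =
      weights ε α O r h i * (1 + step ε α O z i) := by
  simp [weights]

variable [MeasurableSpace X]

lemma measurable_step (hO : Measurable fun p : (Fin mS → X × Bool) × X => O p.1 p.2) (i : Fin k) :
    Measurable fun z : Round X k mS mT => step ε α O z i := by
  have hO_round : Measurable fun p : Round X k mS mT × X => O p.1.1 p.2 :=
    hO.comp ((measurable_fst.comp measurable_fst).prodMk measurable_snd)
  have hT : Measurable fun z : Round X k mS mT => empErr (z.2 i) (O z.1) :=
    measurable_empErr_comp hO_round ((measurable_pi_apply i).comp measurable_snd)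
  have hS : Measurable fun z : Round X k mS mT => empErr z.1 (O z.1) :=
    measurable_empErr_comp hO_round measurable_fst
  exact ((hT.mul_const _).mul_const _).div ((hS.const_mul _).add_const _)

lemma measurable_weights (hO : Measurable fun p : (Fin mS → X × Bool) × X => O p.1 p.2) (r : ℕ) :
    Measurable fun h : Fin r → Round X k mS mT => weights ε α O r h := by
  induction r with
  | zero => exact measurable_const (a := (1 : Fin k → ℝ))
  | succ r ih =>
    have hinit : Measurable fun (h : Fin (r + 1) → Round X k mS mT) (j : Fin r) => h j.castSucc :=
      measurable_pi_lambda _ fun _ => measurable_pi_apply _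
    exact measurable_pi_lambda _ fun i => ((measurable_pi_apply i).comp (ih.comp hinit)).mul
      (((measurable_step hO i).comp (measurable_pi_apply (Fin.last r))).const_add 1)

variable {D : Fin k → Measure (X × Bool)} [∀ i, IsProbabilityMeasure (D i)] [NeZero k]

lemma isProbabilityMeasure_roundLaw {w : Fin k → ℝ} (hw : ∀ i, 0 < w i) :
    IsProbabilityMeasure (roundLaw D w : Measure (Round X k mS mT)) := by
  have := isProbabilityMeasure_mixture (D := D) hw
  rw [roundLaw]
  infer_instance

lemma measurable_roundLaw {A : Type*} [MeasurableSpace A] {w : A → Fin k → ℝ}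
    (hw : Measurable w) (hpos : ∀ x i, 0 < w x i) :
    Measurable fun x => (roundLaw D (w x) : Measure (Round X k mS mT)) := by
  have hmixture_prob (x) : IsProbabilityMeasure (mixture D (w x)) :=
    isProbabilityMeasure_mixture (hpos x)
  have hround_prob (x) : IsProbabilityMeasure (roundLaw D (w x) : Measure (Round X k mS mT)) :=
    isProbabilityMeasure_roundLaw (hpos x)
  have hw_apply (i) : Measurable fun x => w x i := (measurable_pi_apply i).comp hw
  have hmixture (s) : Measurable fun x => mixture D (w x) s := by
    simp only [mixture, Measure.coe_finsetSum, Finset.sum_apply, Measure.smul_apply, smul_eq_mul]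
    exact Finset.measurable_fun_sum _ fun i _ => (((hw_apply i).div
      (Finset.measurable_fun_sum _ fun j _ => hw_apply j)).ennreal_ofReal).mul_const _
  have hpi : Measurable fun x => Measure.pi fun _ : Fin mS => mixture D (w x) := by
    refine Measurable.measure_of_isPiSystem_of_isProbabilityMeasure generateFrom_pi.symm
      isPiSystem_pi ?_
    rintro _ ⟨s, -, rfl⟩
    simp_rw [Measure.pi_pi]
    exact Finset.measurable_fun_prod _ fun j _ => hmixture _
  refine Measurable.measure_of_isPiSystem_of_isProbabilityMeasure generateFrom_prod.symm
    isPiSystem_prod ?_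
  rintro _ ⟨s, hs : MeasurableSet s, t, -, rfl⟩
  simp_rw [roundLaw, Measure.prod_prod]
  exact ((Measure.measurable_coe hs).comp hpi).mul_const _

/-- The law of the samples of the next round, as a kernel from the samples of the first `r`. -/
noncomputable def roundKernel (mT : ℕ) (D : Fin k → Measure (X × Bool))
    [∀ i, IsProbabilityMeasure (D i)] (hε : 0 < ε) (hα : 0 < α)
    (hO : Measurable fun p : (Fin mS → X × Bool) × X => O p.1 p.2) (r : ℕ) :
    Kernel (Fin r → Round X k mS mT) (Round X k mS mT) where
  toFun h := roundLaw D (weights ε α O r h)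
  measurable' := measurable_roundLaw (measurable_weights hO r) (weights_pos hε hα r)

variable {hε : 0 < ε} {hα : 0 < α} {hO : Measurable fun p : (Fin mS → X × Bool) × X => O p.1 p.2}

instance isMarkovKernel_roundKernel (r : ℕ) : IsMarkovKernel (roundKernel mT D hε hα hO r) :=
  ⟨fun h => isProbabilityMeasure_roundLaw (weights_pos hε hα r h)⟩

lemma law_eq_adaptiveLaw (r : ℕ) :
    law ε α D O r = adaptiveLaw (roundKernel mT D hε hα hO) r := by
  induction r with
  | zero => rfl
  | succ r ih =>
    rw [law, adaptiveLaw, Measure.compProd_eq_comp_prod, Measure.map_comp _ _ measurable_snoc, ih]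
    congr 1
    funext h
    rw [Kernel.map_apply _ measurable_snoc, Kernel.prod_apply, Kernel.id_apply, Measure.dirac_prod,
      Measure.map_map measurable_snoc measurable_prodMk_left]
    rfl

end Algorithm

section MultiplicativeWeights

variable {ι : Type*} [Fintype ι] [Nonempty ι] {w s : ι → ℝ}

lemma log_sum_mul_one_add_le (hw : ∀ i, 0 < w i) (hs : ∀ i, 0 ≤ s i) :
    Real.log (∑ i, w i * (1 + s i)) ≤ Real.log (∑ i, w i) + ∑ i, w i / (∑ j, w j) * s i := by
  have hsum : 0 < ∑ i, w i := Finset.sum_pos (fun i _ => hw i) Finset.univ_nonempty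
  have hgain : 0 < 1 + ∑ i, w i / (∑ j, w j) * s i :=
    add_pos_of_pos_of_nonneg one_pos <| Finset.sum_nonneg fun i _ =>
      mul_nonneg (div_pos (hw i) hsum).le (hs i)
  have hfactor : ∑ i, w i * (1 + s i) = (∑ i, w i) * (1 + ∑ i, w i / (∑ j, w j) * s i) := by
    simp only [mul_add, mul_one, Finset.sum_add_distrib, Finset.mul_sum]
    congr! 2 with i
    field_simp
  rw [hfactor, Real.log_mul hsum.ne' hgain.ne']
  linarith [Real.log_le_sub_one_of_pos hgain]

omit [Nonempty ι] in
lemma log_le_log_sum (hw : ∀ i, 0 < w i) (i : ι) : Real.log (w i) ≤ Real.log (∑ j, w j) :=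
  Real.log_le_log (hw i) (Finset.single_le_sum (fun j _ => (hw j).le) (Finset.mem_univ i))

lemma mul_le_log_one_add {a s : ℝ} (hs : 0 ≤ s) (hsa : s ≤ a / 3) :
    (1 - a / 6) * s ≤ Real.log (1 + s) := by
  refine le_trans ?_ (Real.le_log_one_add_of_nonneg hs)
  rw [le_div_iff₀ (by linarith)]
  nlinarith [mul_nonneg hs hs]

end MultiplicativeWeights

section Potential

variable {X : Type*} {k mS mT : ℕ}

/-- The quantity that the steps of a round are normalized by, with `a` for `α'` and `e` for
`ε'`. -/
noncomputable def den {n : ℕ} (a e : ℝ) (S : Fin n → X × Bool) (f : X → Bool) : ℝ :=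
  (1 + 3 * a) * empErr S f + 3 * e

lemma three_mul_le_den {n : ℕ} {a : ℝ} (ha : 0 ≤ a) (e : ℝ) (S : Fin n → X × Bool)
    (f : X → Bool) : 3 * e ≤ den a e S f :=
  le_add_of_nonneg_left (mul_nonneg (by positivity) (empErr_nonneg S f))

lemma den_pos {n : ℕ} {a e : ℝ} (ha : 0 ≤ a) (he : 0 < e) (S : Fin n → X × Bool) (f : X → Bool) :
    0 < den a e S f :=
  lt_of_lt_of_le (by positivity) (three_mul_le_den ha e S f)

variable {ε α : ℝ} {O : (Fin mS → X × Bool) → X → Bool}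

lemma step_eq_div_den (z : Round X k mS mT) (i : Fin k) : step ε α O z i =
    empErr (z.2 i) (O z.1) * eps' ε * alpha' α / den (alpha' α) (eps' ε) z.1 (O z.1) := rfl

lemma step_le (hε : 0 < ε) (hα : 0 < α) (z : Round X k mS mT) (i : Fin k) :
    step ε α O z i ≤ alpha' α / 3 := by
  have he := eps'_pos hε
  have ha := alpha'_pos hα
  rw [step_eq_div_den, div_le_iff₀ (den_pos ha.le he _ _)]
  calc empErr (z.2 i) (O z.1) * eps' ε * alpha' α ≤ 1 * eps' ε * alpha' α := by
        gcongr
        exact empErr_le_one _ _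
    _ = alpha' α / 3 * (3 * eps' ε) := by ring
    _ ≤ alpha' α / 3 * den (alpha' α) (eps' ε) z.1 (O z.1) := by
        gcongr
        exact three_mul_le_den ha.le _ _ _

variable [MeasurableSpace X]

/-- The potential of player `i` after `r` rounds: it is large if the classifiers of the rounds have
a large total error on `D i`, measured relative to `den`. -/
noncomputable def potential (ε α : ℝ) (D : Fin k → Measure (X × Bool))
    (O : (Fin mS → X × Bool) → X → Bool) (i : Fin k) (r : ℕ) (h : Fin r → Round X k mS mT) : ℝ :=
  Real.log (∑ l, weights ε α O r h l) - Real.log (weights ε α O r h i) +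
    eps' ε * alpha' α * ((1 - alpha' α / 3) * ∑ j : Fin r, err (D i) (O (h j).1) /
      den (alpha' α) (eps' ε) (h j).1 (O (h j).1) - r)

/-- A bound for the change of the potential of player `i` in a round with weights `w`. -/
noncomputable def increment (ε α : ℝ) (D : Fin k → Measure (X × Bool))
    (O : (Fin mS → X × Bool) → X → Bool) (i : Fin k) (w : Fin k → ℝ) (z : Round X k mS mT) : ℝ :=
  ∑ l, w l / (∑ j, w j) * step ε α O z l - (1 - alpha' α / 6) * step ε α O z i +
    eps' ε * alpha' α *
      ((1 - alpha' α / 3) * (err (D i) (O z.1) / den (alpha' α) (eps' ε) z.1 (O z.1)) - 1)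

variable {D : Fin k → Measure (X × Bool)}

lemma potential_zero (i : Fin k) (h : Fin 0 → Round X k mS mT) :
    potential ε α D O i 0 h = Real.log k := by
  simp [potential, weights]

lemma le_potential (hε : 0 < ε) (hα : 0 < α) (i : Fin k) {r : ℕ} (h : Fin r → Round X k mS mT) :
    eps' ε * alpha' α * ((1 - alpha' α / 3) * ∑ j : Fin r, err (D i) (O (h j).1) /
      den (alpha' α) (eps' ε) (h j).1 (O (h j).1) - r) ≤ potential ε α D O i r h :=
  le_add_of_nonneg_left (sub_nonneg.2 (log_le_log_sum (weights_pos hε hα r h) i))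

lemma potential_snoc_le (hε : 0 < ε) (hα : 0 < α) (i : Fin k) {r : ℕ}
    (h : Fin r → Round X k mS mT) (z : Round X k mS mT) :
    potential ε α D O i (r + 1) (Fin.snoc (α := fun _ => Round X k mS mT) h z) ≤
      potential ε α D O i r h + increment ε α D O i (weights ε α O r h) z := by
  have : Nonempty (Fin k) := ⟨i⟩
  have hpos := weights_pos (O := O) hε hα r h
  have hstep := step_nonneg (O := O) hε hα z
  have hlog_sum := log_sum_mul_one_add_le hpos hstep
  have hlog_self : Real.log (weights ε α O r h i) + (1 - alpha' α / 6) * step ε α O z i ≤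
      Real.log (weights ε α O r h i * (1 + step ε α O z i)) := by
    rw [Real.log_mul (hpos i).ne' (by linarith [hstep i])]
    linarith [mul_le_log_one_add (hstep i) (step_le hε hα z i)]
  simp only [potential, increment, weights_snoc, Fin.sum_univ_castSucc, Fin.snoc_castSucc,
    Fin.snoc_last, Nat.cast_add, Nat.cast_one]
  linarith

lemma mul_increment_eq (hε : 0 < ε) (hα : 0 < α) (i : Fin k) (w : Fin k → ℝ)
    (S : Fin mS → X × Bool) (T : Fin k → Fin mT → X × Bool) :
    mT / 2 * increment ε α D O i w (S, T) =
      mT * (eps' ε * alpha' α / (2 * den (alpha' α) (eps' ε) S (O S)) *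
        ((1 - alpha' α / 3) * err (D i) (O S) - den (alpha' α) (eps' ε) S (O S))) +
      mT * (eps' ε * alpha' α / (2 * den (alpha' α) (eps' ε) S (O S)) *
        (∑ l, w l / (∑ j, w j) * empErr (T l) (O S) -
          (1 - alpha' α / 6) * empErr (T i) (O S))) := by
  have hq := (den_pos (alpha'_pos hα).le (eps'_pos hε) S (O S)).ne'
  have hsum : ∑ l, w l / (∑ j, w j) * step ε α O (S, T) l = eps' ε * alpha' α /
      den (alpha' α) (eps' ε) S (O S) * ∑ l, w l / (∑ j, w j) * empErr (T l) (O S) := by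
    rw [Finset.mul_sum]
    exact Finset.sum_congr rfl fun l _ => by rw [step_eq_div_den]; ring
  rw [increment, hsum, step_eq_div_den]
  field_simp
  ring

lemma measurable_potential [∀ i, IsProbabilityMeasure (D i)]
    (hO : Measurable fun p : (Fin mS → X × Bool) × X => O p.1 p.2) (i : Fin k) (r : ℕ) :
    Measurable fun h : Fin r → Round X k mS mT => potential ε α D O i r h := by
  have hweight (l) : Measurable fun h : Fin r → Round X k mS mT => weights ε α O r h l :=
    (measurable_pi_apply l).comp (measurable_weights hO r)
  have hsample (j) : Measurable fun h : Fin r → Round X k mS mT => (h j).1 :=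
    measurable_fst.comp (measurable_pi_apply j)
  have hden : Measurable fun S : Fin mS → X × Bool => den (alpha' α) (eps' ε) S (O S) :=
    ((measurable_empErr_comp hO measurable_id).const_mul _).add_const _
  have hratio (j : Fin r) : Measurable fun h : Fin r → Round X k mS mT =>
      err (D i) (O (h j).1) / den (alpha' α) (eps' ε) (h j).1 (O (h j).1) :=
    ((measurable_err_comp hO (D i)).div hden).comp (hsample j)
  exact ((Finset.measurable_fun_sum _ fun l _ => hweight l).log.sub (hweight i).log).add
    ((((Finset.measurable_fun_sum _ fun j _ => hratio j).const_mul _).sub_const _).const_mul _)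

end Potential

section ExpectedIncrement

variable {X : Type*} [MeasurableSpace X]

lemma coeff_add_sq_le {a l p q : ℝ} (ha : 0 ≤ a) (ha1 : a ≤ 1) (hl : 0 ≤ l) (hla : l ≤ a / 6)
    (hp : 0 ≤ p) (hp1 : p ≤ 1) (hq : 0 ≤ q) (hq1 : q ≤ 1) :
    l * (p - (1 - a / 6) * q) + (l * (p - (1 - a / 6) * q)) ^ 2 ≤
      l * ((1 + a / 6) * p - (1 - a / 3) * q) := by
  have hu : 0 ≤ (1 - a / 6) * q := mul_nonneg (by linarith) hq
  have huq : (1 - a / 6) * q ≤ q := mul_le_of_le_one_left hq (by linarith)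
  have hsq : (p - (1 - a / 6) * q) ^ 2 ≤ p + q := by nlinarith [mul_nonneg hp hu]
  calc l * (p - (1 - a / 6) * q) + (l * (p - (1 - a / 6) * q)) ^ 2
      = l * (p - (1 - a / 6) * q) + l * (l * (p - (1 - a / 6) * q) ^ 2) := by ring
    _ ≤ l * (p - (1 - a / 6) * q) + l * (a / 6 * (p + q)) := by gcongr
    _ = l * ((1 + a / 6) * p - (1 - a / 3) * q) := by ring

theorem expMoment_sum_sub_le {ι : Type*} [Fintype ι] {n : ℕ} {D : ι → Measure (X × Bool)}
    [∀ i, IsProbabilityMeasure (D i)] {f : X → Bool} (hf : Measurable f) {a l : ℝ} (ha : 0 ≤ a)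
    (ha1 : a ≤ 1) (hl : 0 ≤ l) (hla : l ≤ a / 6) {p : ι → ℝ} (hp : ∀ j, 0 ≤ p j)
    (hp1 : ∀ j, p j ≤ 1) (i : ι) :
    expMoment (Measure.pi fun i => Measure.pi fun _ : Fin n => D i)
        (fun T => n * (l * (∑ j, p j * empErr (T j) f - (1 - a / 6) * empErr (T i) f))) ≤
      ENNReal.ofReal (Real.exp
        (n * (l * ((1 + a / 6) * ∑ j, p j * err (D j) f - (1 - a / 3) * err (D i) f)))) := by
  classical
  let q : ι → ℝ := Pi.single i 1
  have hq (j) : 0 ≤ q j := by by_cases h : j = i <;> simp [q, h]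
  have hq1 (j) : q j ≤ 1 := by by_cases h : j = i <;> simp [q, h]
  have hsum (c : ℝ) (c' : ℝ) (x : ι → ℝ) :
      ∑ j, (c * p j - c' * q j) * x j = c * ∑ j, p j * x j - c' * x i := by
    simp [q, sub_mul, Finset.sum_sub_distrib, Finset.mul_sum, mul_assoc, Pi.single_apply]
  have hcoeff (j) : |l * (p j - (1 - a / 6) * q j)| ≤ 1 := by
    have := mul_nonneg ha (hq j)
    rw [abs_mul, abs_of_nonneg hl]
    exact mul_le_one₀ (by linarith) (abs_nonneg _)
      (abs_le.2 ⟨by linarith [hp j, hq1 j], by nlinarith [hp1 j, hq j]⟩)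
  calc _ = expMoment (Measure.pi fun i => Measure.pi fun _ : Fin n => D i)
        (fun T => ∑ j, l * (p j - (1 - a / 6) * q j) * (n * empErr (T j) f)) := by
        congr! with T
        have := hsum 1 (1 - a / 6) fun j => empErr (T j) f
        simp only [one_mul] at this
        rw [← this, Finset.mul_sum, Finset.mul_sum]
        exact Finset.sum_congr rfl fun j _ => by ring
    _ ≤ _ := expMoment_sum_mul_empErr_le hf hcoeff
    _ ≤ _ := by
        rw [← hsum]
        gcongr
        rw [Finset.mul_sum]
        refine Finset.sum_le_sum fun j _ => ?_
        rw [← mul_assoc, mul_comm (err (D j) f)]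
        exact mul_le_mul_of_nonneg_right
          (coeff_add_sq_le ha ha1 hl hla (hp j) (hp1 j) (hq j) (hq1 j)) (err_nonneg _ _)

end ExpectedIncrement

section GoodRound

variable {X : Type*} [MeasurableSpace X] {k mS mT : ℕ} {ε α : ℝ} {D : Fin k → Measure (X × Bool)}
  {O : (Fin mS → X × Bool) → X → Bool}

/-- The condition on the sample `S` from the mixture, in a round with weights `w`, under which the
potentials of the players do not grow and the normalization of the steps is bounded in terms
of `B`. -/
def GoodRound (a e B : ℝ) (D : Fin k → Measure (X × Bool)) (O : (Fin mS → X × Bool) → X → Bool)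
    (w : Fin k → ℝ) (S : Fin mS → X × Bool) : Prop :=
  err (mixture D w) (O S) ≤ (1 + a) * empErr S (O S) + e ∧ empErr S (O S) ≤ B

lemma GoodRound.den_le {a e B : ℝ} (ha : 0 ≤ a) {w : Fin k → ℝ} {S : Fin mS → X × Bool}
    (hS : GoodRound a e B D O w S) : den a e S (O S) ≤ (1 + 3 * a) * B + 3 * e := by
  rw [den]
  gcongr
  exact hS.2

lemma GoodRound.err_mixture_le_den {a e B : ℝ} (ha : 0 ≤ a) (ha1 : a ≤ 1) (he : 0 ≤ e)
    {w : Fin k → ℝ} {S : Fin mS → X × Bool} (hS : GoodRound a e B D O w S) :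
    (1 + a / 6) * err (mixture D w) (O S) ≤ den a e S (O S) := by
  have hemp := empErr_nonneg S (O S)
  calc (1 + a / 6) * err (mixture D w) (O S)
      ≤ (1 + a / 6) * ((1 + a) * empErr S (O S) + e) := by
        gcongr
        exact hS.1
    _ = (1 + a / 6) * (1 + a) * empErr S (O S) + (1 + a / 6) * e := by ring
    _ ≤ (1 + 3 * a) * empErr S (O S) + 3 * e := by
        gcongr
        · nlinarith
        · linarith

variable [∀ i, IsProbabilityMeasure (D i)]

lemma measurableSet_goodRound (hO : Measurable fun p : (Fin mS → X × Bool) × X => O p.1 p.2)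
    {A : Type*} [MeasurableSpace A] {w : A → Fin k → ℝ} (hw : Measurable w)
    (hpos : ∀ x i, 0 < w x i) {S : A → Fin mS → X × Bool} (hS : Measurable S) (a e B : ℝ) :
    MeasurableSet {x | GoodRound a e B D O (w x) (S x)} := by
  have hw_apply (i) : Measurable fun x => w x i := (measurable_pi_apply i).comp hw
  have hempErr : Measurable fun x => empErr (S x) (O (S x)) :=
    (measurable_empErr_comp hO measurable_id).comp hS
  have herr : Measurable fun x => err (mixture D (w x)) (O (S x)) := by
    simp only [err_mixture fun i => (hpos _ i).le]
    exact Finset.measurable_fun_sum _ fun i _ => ((hw_apply i).div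
      (Finset.measurable_fun_sum _ fun j _ => hw_apply j)).mul
        ((measurable_err_comp hO (D i)).comp hS)
  exact (measurableSet_le herr ((hempErr.const_mul _).add_const _)).inter
    (measurableSet_le hempErr measurable_const)

variable [NeZero k]

theorem measure_not_goodRound_le {F : Set (X → Bool)} {d : ℕ} (hF : HasVCDim F d) {a e : ℝ}
    (ha : 0 < a) (ha1 : a ≤ 1) (he : 0 < e) (he1 : e ≤ 1) (hO : IsERM F e O) {f : X → Bool}
    (hfF : f ∈ F) (hf : Measurable f) {b : ℝ} (hb : ∀ i, err (D i) f ≤ b) {w : Fin k → ℝ}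
    (hw : ∀ i, 0 < w i) :
    (Measure.pi fun _ : Fin mS => mixture D w)
      {S | ¬ GoodRound a e ((1 + a) * b + 2 * e) D O w S} ≤
      ENNReal.ofReal ((24 / (a * e)) ^ d * Real.exp (-(a * e / 12 * mS))) +
        ENNReal.ofReal (Real.exp (-(a * e * mS))) := by
  have := isProbabilityMeasure_mixture (D := D) hw
  refine le_trans ?_ (add_le_add
    (measure_err_gt_le hF ha ha1 he he1 (mixture D w) hO.measurable hO.mem)
    (measure_empErr_gt_le ha.le ha1 e (mixture D w) hf))
  refine (measure_mono fun S hS => ?_).trans (measure_union_le _ _)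
  refine or_iff_not_imp_left.2 fun hgeneralize => ?_
  by_contra hf_fits
  simp only [Set.mem_ofPred_eq, not_lt] at hgeneralize hf_fits
  refine hS ⟨hgeneralize, ?_⟩
  have hbdd : BddBelow (Set.range fun g : F => empErr S g) :=
    ⟨0, by rintro _ ⟨g, rfl⟩; exact empErr_nonneg S g⟩
  calc empErr S (O S) ≤ (⨅ g : F, empErr S g) + e := hO.empErr_le S
    _ ≤ ((1 + a) * err (mixture D w) f + e) + e := by
        gcongr
        exact (ciInf_le hbdd ⟨f, hfF⟩).trans hf_fits
    _ ≤ ((1 + a) * b + e) + e := by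
        gcongr
        exact err_mixture_le hw hb
    _ = (1 + a) * b + 2 * e := by ring

lemma expMoment_increment_le (hε : 0 < ε) (hα : 0 < α) (hα1 : α ≤ 1) {B : ℝ} (i : Fin k)
    {w : Fin k → ℝ} (hw : ∀ i, 0 < w i) {S : Fin mS → X × Bool} (hf : Measurable (O S))
    (hS : GoodRound (alpha' α) (eps' ε) B D O w S) :
    expMoment (Measure.pi fun i => Measure.pi fun _ : Fin mT => D i)
      (fun T => mT / 2 * increment ε α D O i w (S, T)) ≤ 1 := by
  have he := eps'_pos hε
  have ha := alpha'_pos hα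
  have ha1 : alpha' α ≤ 1 := by rw [alpha']; linarith
  have hsum : 0 < ∑ l, w l := Finset.sum_pos (fun l _ => hw l) Finset.univ_nonempty
  have hincrement := mul_increment_eq (mT := mT) (D := D) (O := O) hε hα i w S
  have hq := den_pos ha.le he S (O S)
  have hq3 := three_mul_le_den ha.le (eps' ε) S (O S)
  have hmix := hS.err_mixture_le_den ha.le ha1 he.le
  rw [err_mixture fun i => (hw i).le] at hmix
  set a := alpha' α
  set e := eps' ε
  set q := den a e S (O S)
  set l := e * a / (2 * q) with hl
  have hl0 : 0 ≤ l := by positivity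
  have hla : l ≤ a / 6 := by
    rw [hl, div_le_iff₀ (by positivity)]
    nlinarith
  have hmoment := expMoment_sum_sub_le (n := mT) (D := D) hf ha.le ha1 hl0 hla
    (fun j => (div_pos (hw j) hsum).le)
    (fun j => (div_le_one hsum).2 (Finset.single_le_sum (fun j _ => (hw j).le)
      (Finset.mem_univ j))) i
  simp only [hincrement, expMoment_const_add]
  refine (mul_le_mul_right hmoment _).trans ?_
  rw [← ENNReal.ofReal_mul (Real.exp_pos _).le, ← Real.exp_add, ← ENNReal.ofReal_one]
  refine ENNReal.ofReal_le_ofReal (Real.exp_le_one_iff.2 ?_)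
  rw [← mul_add, ← mul_add]
  exact mul_nonpos_of_nonneg_of_nonpos (Nat.cast_nonneg _)
    (mul_nonpos_of_nonneg_of_nonpos hl0 (by linarith))

lemma expMoment_roundLaw_increment_le (hε : 0 < ε) (hα : 0 < α) (hα1 : α ≤ 1)
    (hO : Measurable fun p : (Fin mS → X × Bool) × X => O p.1 p.2) (B : ℝ) (i : Fin k)
    {w : Fin k → ℝ} (hw : ∀ i, 0 < w i) :
    expMoment ((roundLaw D w).restrict {z | GoodRound (alpha' α) (eps' ε) B D O w z.1})
      (fun z : Round X k mS mT => mT / 2 * increment ε α D O i w z) ≤ 1 := by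
  have := isProbabilityMeasure_mixture (D := D) hw
  set good := {S | GoodRound (alpha' α) (eps' ε) B D O w S}
  have hgood : MeasurableSet good :=
    measurableSet_goodRound hO measurable_const (fun _ => hw) measurable_id _ _ _
  have hrestrict : (roundLaw D w : Measure (Round X k mS mT)).restrict {z | z.1 ∈ good} =
      ((Measure.pi fun _ : Fin mS => mixture D w).restrict good).prod
        (Measure.pi fun i => Measure.pi fun _ : Fin mT => D i) := by
    rw [roundLaw, ← Measure.restrict_univ (μ := Measure.pi fun i => Measure.pi fun _ => D i),
      Measure.prod_restrict, Set.prod_univ, Measure.restrict_univ]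
    rfl
  calc expMoment ((roundLaw D w).restrict {z | z.1 ∈ good})
        (fun z : Round X k mS mT => mT / 2 * increment ε α D O i w z)
      ≤ ∫⁻ S in good, expMoment (Measure.pi fun i => Measure.pi fun _ : Fin mT => D i)
          (fun T => mT / 2 * increment ε α D O i w (S, T)) ∂Measure.pi fun _ => mixture D w := by
        rw [hrestrict]
        exact lintegral_prod_le _
    _ ≤ ∫⁻ _ in good, 1 ∂Measure.pi fun _ => mixture D w :=
        setLIntegral_mono' hgood fun S hS => expMoment_increment_le hε hα hα1 i hw
          (hO.comp measurable_prodMk_left) hS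
    _ ≤ 1 := by
        rw [setLIntegral_one]
        exact prob_le_one

lemma roundLaw_not_goodRound_le {F : Set (X → Bool)} {d : ℕ} (hF : HasVCDim F d) {a e : ℝ}
    (ha : 0 < a) (ha1 : a ≤ 1) (he : 0 < e) (he1 : e ≤ 1) (hO : IsERM F e O) {f : X → Bool}
    (hfF : f ∈ F) (hf : Measurable f) {b : ℝ} (hb : ∀ i, err (D i) f ≤ b) {w : Fin k → ℝ}
    (hw : ∀ i, 0 < w i) :
    roundLaw D w {z : Round X k mS mT | ¬ GoodRound a e ((1 + a) * b + 2 * e) D O w z.1} ≤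
      ENNReal.ofReal ((24 / (a * e)) ^ d * Real.exp (-(a * e / 12 * mS))) +
        ENNReal.ofReal (Real.exp (-(a * e * mS))) := by
  have := isProbabilityMeasure_mixture (D := D) hw
  have hgood : MeasurableSet {S | GoodRound a e ((1 + a) * b + 2 * e) D O w S} :=
    measurableSet_goodRound hO.measurable measurable_const (fun _ => hw) measurable_id _ _ _
  exact (measurePreserving_fst.measure_preimage hgood.compl.nullMeasurableSet).trans_le
    (measure_not_goodRound_le hF ha ha1 he he1 hO hfF hf hb hw)

lemma expMoment_potential_snoc_le (hε : 0 < ε) (hα : 0 < α) (hα1 : α ≤ 1)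
    (hO : Measurable fun p : (Fin mS → X × Bool) × X => O p.1 p.2) (B : ℝ) (i : Fin k) {r : ℕ}
    (h : Fin r → Round X k mS mT) :
    expMoment ((roundLaw D (weights ε α O r h)).restrict
        {z | GoodRound (alpha' α) (eps' ε) B D O (weights ε α O r h) z.1}) (fun z =>
      mT / 2 * potential ε α D O i (r + 1) (Fin.snoc (α := fun _ => Round X k mS mT) h z)) ≤
        ENNReal.ofReal (Real.exp (mT / 2 * potential ε α D O i r h)) := by
  have hstep (z : Round X k mS mT) := mul_le_mul_of_nonneg_left
    (potential_snoc_le (D := D) (O := O) hε hα i h z) (by positivity : 0 ≤ (mT : ℝ) / 2)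
  simp only [mul_add] at hstep
  refine (expMoment_mono hstep).trans ?_
  rw [expMoment_const_add]
  exact mul_le_of_le_one_right'
    (expMoment_roundLaw_increment_le hε hα hα1 hO B i (weights_pos hε hα r h))

theorem le_law_goodRound_and_potential_lt {F : Set (X → Bool)} {d : ℕ} (hF : HasVCDim F d)
    (hε : 0 < ε) (hε1 : ε ≤ 1) (hα : 0 < α) (hα1 : α ≤ 1) (hO : IsERM F (eps' ε) O)
    {f : X → Bool} (hfF : f ∈ F) (hf : Measurable f) {b : ℝ} (hb : ∀ i, err (D i) f ≤ b) (t : ℕ)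
    (c : ℝ) :
    1 - (t * (ENNReal.ofReal ((24 / (alpha' α * eps' ε)) ^ d *
        Real.exp (-(alpha' α * eps' ε / 12 * mS))) +
          ENNReal.ofReal (Real.exp (-(alpha' α * eps' ε * mS)))) +
        k * ENNReal.ofReal (Real.exp (-c))) ≤
      law ε α D O t {h : Fin t → Round X k mS mT |
        (∀ j, ∃ w, GoodRound (alpha' α) (eps' ε) ((1 + alpha' α) * b + 2 * eps' ε) D O w (h j).1) ∧
        ∀ i, mT / 2 * potential ε α D O i t h < mT / 2 * Real.log k + c} := by
  have he1 : eps' ε ≤ 1 := by rw [eps']; linarith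
  have ha1 : alpha' α ≤ 1 := by rw [alpha']; linarith
  let good (r : ℕ) (h : Fin r → Round X k mS mT) (z : Round X k mS mT) : Prop :=
    GoodRound (alpha' α) (eps' ε) ((1 + alpha' α) * b + 2 * eps' ε) D O (weights ε α O r h) z.1
  have hgood (r : ℕ) : MeasurableSet {p : (Fin r → Round X k mS mT) × _ | good r p.1 p.2} :=
    measurableSet_goodRound hO.measurable ((measurable_weights hO.measurable r).comp measurable_fst)
      (fun p => weights_pos hε hα r p.1) (measurable_fst.comp measurable_snd) _ _ _
  have hsuccess := le_adaptiveLaw_allGood_and_forall_lt (κ := roundKernel mT D hε hα hO.measurable)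
    hgood
    (fun r h => roundLaw_not_goodRound_le hF (alpha'_pos hα) ha1 (eps'_pos hε) he1 hO hfF hf hb
      (weights_pos hε hα r h))
    (fun i r => (measurable_potential hO.measurable i r).const_mul (mT / 2))
    (fun i r h => expMoment_potential_snoc_le hε hα hα1 hO.measurable _ i h) t c
  rw [Fintype.card_fin, ← law_eq_adaptiveLaw] at hsuccess
  refine hsuccess.trans (measure_mono fun h hh => ⟨?_, fun i => ?_⟩)
  · exact hh.1.forall
      (p := fun z => ∃ w, GoodRound (alpha' α) (eps' ε) ((1 + alpha' α) * b + 2 * eps' ε) D O w z.1)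
      fun r h z hz => ⟨weights ε α O r h, hz⟩
  · simpa only [potential_zero] using hh.2 i

end GoodRound

section Output

variable {X : Type*}

lemma uniformClassifier_real_ne {t : ℕ} [NeZero t] (f : Fin t → X → Bool) (z : X × Bool) :
    (uniformClassifier f z.1).real {b | b ≠ z.2} =
      (∑ r, {z : X × Bool | f r z.1 ≠ z.2}.indicator 1 z) / t := by
  classical
  have hpreimage : (fun r => f r z.1) ⁻¹' {b | b ≠ z.2} =
      (Finset.univ.filter fun r => f r z.1 ≠ z.2 : Set (Fin t)) := by
    ext r
    simp
  rw [uniformClassifier, Measure.real, Measure.map_apply (measurable_of_finite _)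
    (Set.toFinite _).measurableSet, uniformOn_univ, ENNReal.toReal_div, hpreimage,
    Measure.count_apply_finset]
  simp only [Set.indicator_apply, Set.mem_ofPred_eq, Pi.one_apply, Finset.sum_boole]
  simp

lemma HasVCDim.nonempty {F : Set (X → Bool)} {d : ℕ} (hF : HasVCDim F d) : F.Nonempty := by
  obtain ⟨A, -, hA⟩ := hF.1
  obtain ⟨f, hf, -⟩ := hA fun _ => true
  exact ⟨f, hf⟩

lemma HasVCDim.subsingleton {F : Set (X → Bool)} (hF : HasVCDim F 0) : F.Subsingleton := by
  intro f hf g hg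
  by_contra hne
  obtain ⟨x, hx⟩ := Function.ne_iff.1 hne
  have hshatters : Shatters F {x} := by
    intro y
    simp only [Finset.mem_singleton, forall_eq]
    rcases Bool.eq_or_eq_not (f x) (y x) with hfy | hfy
    · exact ⟨f, hf, hfy⟩
    · exact ⟨g, hg, by cases hgx : g x <;> simp_all⟩
  exact absurd (hF.2 ⟨{x}, Finset.card_singleton x, hshatters⟩) (by simp)

variable [MeasurableSpace X]

theorem expErr_uniformClassifier {t : ℕ} [NeZero t] (D : Measure (X × Bool)) [IsFiniteMeasure D]
    {f : Fin t → X → Bool} (hf : ∀ r, Measurable (f r)) :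
    expErr D (uniformClassifier f) = (∑ r, err D (f r)) / t := by
  have hmeas (r) : MeasurableSet {z : X × Bool | f r z.1 ≠ z.2} :=
    (measurableSet_eq_fun ((hf r).comp measurable_fst) measurable_snd).compl
  simp only [expErr, uniformClassifier_real_ne]
  rw [integral_div,
    integral_finsetSum (f := fun r => {z : X × Bool | f r z.1 ≠ z.2}.indicator 1) _ fun r _ =>
      (integrable_const (1 : ℝ)).indicator (hmeas r)]
  simp only [integral_indicator_one (hmeas _), err]

variable {k : ℕ} (D : Fin k → Measure (X × Bool))

lemma exists_err_le_opt_add {F : Set (X → Bool)} (hF : F.Nonempty) {η : ℝ} (hη : 0 < η) :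
    ∃ f ∈ F, ∀ i, err (D i) f ≤ opt D F + η := by
  have : Nonempty F := hF.to_subtype
  obtain ⟨f, hf⟩ := exists_lt_of_ciInf_lt (show opt D F < opt D F + η by linarith)
  exact ⟨f, f.2, fun i =>
    (le_ciSup (f := fun i => err (D i) f) (Set.finite_range _).bddAbove i).trans hf.le⟩

lemma opt_nonneg (F : Set (X → Bool)) : 0 ≤ opt D F :=
  Real.iInf_nonneg fun f => Real.iSup_nonneg fun i => err_nonneg (D i) f

end Output

section Sizes

variable {k d : ℕ} {ε δ α : ℝ}

lemma le_one_div_eps' (hε : 0 < ε) (hε1 : ε ≤ 1) : 25 ≤ 1 / eps' ε := by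
  rw [le_div_iff₀ (eps'_pos hε), eps']
  linarith

lemma one_le_log_one_div_eps' (hε : 0 < ε) (hε1 : ε ≤ 1) : 1 ≤ Real.log (1 / eps' ε) := by
  rw [Real.le_log_iff_exp_le (one_div_pos.2 (eps'_pos hε))]
  linarith [le_one_div_eps' hε hε1, Real.exp_one_lt_three]

lemma two_mul_eps'_le_alpha' (hα : 24 * ε / 25 ≤ α) : 2 * eps' ε ≤ alpha' α := by
  rw [eps', alpha']
  linarith

lemma one_div_alpha'_mul_eps' : 1 / (alpha' α * eps' ε) = 300 / (α * ε) := by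
  rw [alpha', eps', div_mul_div_comm, one_div_div]
  norm_num

lemma le_one_div_alpha'_mul_eps' (hε : 0 < ε) (hε1 : ε ≤ 1) (hα : 0 < α) (hα1 : α ≤ 1) :
    300 ≤ 1 / (alpha' α * eps' ε) := by
  rw [one_div_alpha'_mul_eps', le_div_iff₀ (by positivity)]
  nlinarith

lemma log_two_le_log_natCast (hk : 2 ≤ k) : Real.log 2 ≤ Real.log k :=
  Real.log_le_log (by norm_num) (by exact_mod_cast hk)

lemma log_two_le_log_div (hk : 2 ≤ k) (hδ : 0 < δ) (hδ1 : δ ≤ 1) :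
    Real.log 2 ≤ Real.log (k / δ) :=
  (log_two_le_log_natCast hk).trans <| Real.log_le_log (by positivity) <|
    le_div_self k.cast_nonneg hδ hδ1

lemma le_log_div_eps'_mul_alpha'_sq (hk : 2 ≤ k) (hε : 0 < ε) (hε1 : ε ≤ 1) (hα : 0 < α)
    (hα1 : α ≤ 1) : 1000 ≤ Real.log k / (eps' ε * alpha' α ^ 2) := by
  have he := eps'_pos hε
  have ha := alpha'_pos hα
  have hprod : eps' ε * alpha' α ^ 2 ≤ 1 / 25 * (1 / 12) ^ 2 := by
    rw [eps', alpha']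
    gcongr
  rw [le_div_iff₀ (by positivity)]
  linarith [Real.log_two_gt_d9, log_two_le_log_natCast hk]

lemma two_mul_le_rounds (k : ℕ) (ε α : ℝ) :
    2 * (Real.log k / (eps' ε * alpha' α ^ 2)) ≤ rounds k ε α := by
  rw [rounds, Nat.cast_mul, Nat.cast_ofNat]
  gcongr
  exact Nat.le_ceil _

lemma two_mul_log_le_rounds_mul (k : ℕ) (hε : 0 < ε) (hα : 0 < α) :
    2 * Real.log k ≤ rounds k ε α * (eps' ε * alpha' α ^ 2) := by
  have hpos : 0 < eps' ε * alpha' α ^ 2 := mul_pos (eps'_pos hε) (pow_pos (alpha'_pos hα) 2)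
  rw [← div_le_iff₀ hpos, mul_div_assoc]
  exact two_mul_le_rounds k ε α

lemma le_alpha'_mul_rounds (hk : 2 ≤ k) (hε : 0 < ε) (hε1 : ε ≤ 1) (hα : 0 < α) (hα1 : α ≤ 1) :
    400 ≤ alpha' α * rounds k ε α := by
  have hpos : 0 < alpha' α * eps' ε := mul_pos (alpha'_pos hα) (eps'_pos hε)
  have hinv := le_one_div_alpha'_mul_eps' hε hε1 hα hα1
  rw [le_div_iff₀ hpos] at hinv
  refine le_of_mul_le_mul_right ?_ hpos
  linarith [two_mul_log_le_rounds_mul k hε hα, Real.log_two_gt_d9, log_two_le_log_natCast hk]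

lemma one_le_rounds (hk : 2 ≤ k) (hε : 0 < ε) (hε1 : ε ≤ 1) (hα : 0 < α) (hα1 : α ≤ 1) :
    1 ≤ rounds k ε α := by
  have hlog := le_log_div_eps'_mul_alpha'_sq hk hε hε1 hα hα1
  exact_mod_cast (show (1 : ℝ) ≤ rounds k ε α by linarith [two_mul_le_rounds k ε α])

lemma rounds_le (hk : 2 ≤ k) (hε : 0 < ε) (hε1 : ε ≤ 1) (hα : 0 < α) (hα1 : α ≤ 1) :
    (rounds k ε α : ℝ) ≤ 14400 * (Real.log k / (ε * α ^ 2)) := by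
  have hlog := le_log_div_eps'_mul_alpha'_sq hk hε hε1 hα hα1
  calc (rounds k ε α : ℝ) = 2 * ⌈Real.log k / (eps' ε * alpha' α ^ 2)⌉₊ := by
        rw [rounds, Nat.cast_mul, Nat.cast_ofNat]
    _ ≤ 2 * (2 * (Real.log k / (eps' ε * alpha' α ^ 2))) := by
        gcongr
        exact Nat.ceil_le_two_mul (by linarith)
    _ = 14400 * (Real.log k / (ε * α ^ 2)) := by
        rw [eps', alpha']
        field_simp
        ring

lemma delta'_pos (hk : 2 ≤ k) (hε : 0 < ε) (hε1 : ε ≤ 1) (hδ : 0 < δ) (hα : 0 < α)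
    (hα1 : α ≤ 1) : 0 < delta' k ε δ α := by
  have hrounds : (1 : ℝ) ≤ rounds k ε α := by exact_mod_cast one_le_rounds hk hε hε1 hα hα1
  rw [delta']
  positivity

lemma delta'_le (hk : 2 ≤ k) (hε : 0 < ε) (hε1 : ε ≤ 1) (hδ : 0 ≤ δ) (hα : 0 < α)
    (hα1 : α ≤ 1) : delta' k ε δ α ≤ δ := by
  have hrounds : (1 : ℝ) ≤ rounds k ε α := by exact_mod_cast one_le_rounds hk hε hε1 hα hα1
  exact div_le_self hδ (by linarith)

lemma log_one_div_delta'_nonneg (hk : 2 ≤ k) (hε : 0 < ε) (hε1 : ε ≤ 1) (hδ : 0 < δ)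
    (hδ1 : δ ≤ 1) (hα : 0 < α) (hα1 : α ≤ 1) : 0 ≤ Real.log (1 / delta' k ε δ α) :=
  Real.log_nonneg <| (one_le_div (delta'_pos hk hε hε1 hδ hα hα1)).2 <|
    (delta'_le hk hε hε1 hδ.le hα hα1).trans hδ1

/-- The number of samples from the mixture in a round. A class of VC dimension `0` has a single
member, so that no samples are needed; the bound on the total number of samples requires this,
because for `d = 0` it leaves no room for the `ln (1 / ε)` that is hidden in `ln (1 / δ')`. -/
noncomputable def mixtureSize (k d : ℕ) (ε δ α : ℝ) : ℕ :=
  if d = 0 then 0 else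
    ⌈48 * (1 / (alpha' α * eps' ε) *
      (d * Real.log (1 / eps' ε) + Real.log (1 / delta' k ε δ α)))⌉₊

/-- The number of samples from each player in a round. -/
noncomputable def playerSize (k : ℕ) (ε δ α : ℝ) : ℕ :=
  ⌈1 / (alpha' α * eps' ε) * Real.log (k / δ)⌉₊

lemma mixtureSize_le (hk : 2 ≤ k) (hε : 0 < ε) (hε1 : ε ≤ 1) (hδ : 0 < δ) (hδ1 : δ ≤ 1)
    (hα : 0 < α) (hα1 : α ≤ 1) : (mixtureSize k d ε δ α : ℝ) ≤
      96 * (1 / (alpha' α * eps' ε) *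
        (d * Real.log (1 / eps' ε) + Real.log (1 / delta' k ε δ α))) := by
  have hinv := le_one_div_alpha'_mul_eps' hε hε1 hα hα1
  have hlogε := one_le_log_one_div_eps' hε hε1
  have hlogδ := log_one_div_delta'_nonneg hk hε hε1 hδ hδ1 hα hα1
  rw [mixtureSize]
  split_ifs with hd
  · rw [Nat.cast_zero]
    positivity
  · have hd1 : (1 : ℝ) ≤ d := by exact_mod_cast Nat.one_le_iff_ne_zero.2 hd
    have hsum : 1 ≤ d * Real.log (1 / eps' ε) + Real.log (1 / delta' k ε δ α) := by nlinarith
    exact (Nat.ceil_le_two_mul (by nlinarith)).trans_eq (by ring)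

lemma le_playerSize (hε : 0 < ε) (hα : 0 < α) {mT : ℕ} (hmT : playerSize k ε δ α ≤ mT) :
    Real.log (k / δ) ≤ alpha' α * eps' ε * mT := by
  have hsize := Nat.ceil_le.1 hmT
  rwa [one_div_mul_eq_div, div_le_iff₀' (mul_pos (alpha'_pos hα) (eps'_pos hε))] at hsize

lemma playerSize_le (hk : 2 ≤ k) (hε : 0 < ε) (hε1 : ε ≤ 1) (hδ : 0 < δ) (hδ1 : δ ≤ 1)
    (hα : 0 < α) (hα1 : α ≤ 1) : (playerSize k ε δ α : ℝ) ≤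
      2 * (1 / (alpha' α * eps' ε) * Real.log (k / δ)) := by
  have hinv := le_one_div_alpha'_mul_eps' hε hε1 hα hα1
  have hlog := log_two_le_log_div hk hδ hδ1
  exact Nat.ceil_le_two_mul (by nlinarith [Real.log_two_gt_d9])

lemma playerSize_le_log_div_delta' (hk : 2 ≤ k) (hε : 0 < ε) (hε1 : ε ≤ 1) (hδ : 0 < δ)
    (hδ1 : δ ≤ 1) (hα : 0 < α) (hα1 : α ≤ 1) : (playerSize k ε δ α : ℝ) ≤
      2 * (1 / (alpha' α * eps' ε) * Real.log (k / delta' k ε δ α)) := by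
  have hδ' := delta'_pos hk hε hε1 hδ hα hα1
  have he := eps'_pos hε
  have ha := alpha'_pos hα
  refine (playerSize_le hk hε hε1 hδ hδ1 hα hα1).trans ?_
  gcongr
  exact delta'_le hk hε hε1 hδ.le hα hα1

lemma log_le_of_le_two_pow {x : ℝ} (hx : 0 < x) {n : ℕ} (hxn : x ≤ 2 ^ n) : Real.log x ≤ n := by
  refine (Real.log_le_log hx hxn).trans ?_
  rw [Real.log_pow]
  exact mul_le_of_le_one_right n.cast_nonneg (by linarith [Real.log_two_lt_d9])

lemma log_one_div_eps'_le (hε : 0 < ε) :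
    Real.log (1 / eps' ε) ≤ 6 * max 1 (Real.log (1 / ε)) := by
  have heq : 1 / eps' ε = 25 * (1 / ε) := by
    rw [eps', one_div_div]
    ring
  have hlog : Real.log 25 ≤ (5 : ℕ) := log_le_of_le_two_pow (by norm_num) (by norm_num)
  rw [heq, Real.log_mul (by norm_num) (by positivity)]
  push_cast at hlog
  linarith [le_max_left 1 (Real.log (1 / ε)), le_max_right 1 (Real.log (1 / ε))]

lemma one_div_delta'_le (hk : 2 ≤ k) (hε : 0 < ε) (hε1 : ε ≤ 1) (hδ : 0 < δ)
    (hα : 24 * ε / 25 ≤ α) (hα1 : α ≤ 1) :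
    1 / delta' k ε δ α ≤ 65536 * (1 / ε) ^ 3 * (k / δ) := by
  have hα0 : 0 < α := by linarith
  have hk0 : (0 : ℝ) < k := by positivity
  have hlogk : Real.log k ≤ k := (Real.log_le_sub_one_of_pos hk0).trans (by linarith)
  calc 1 / delta' k ε δ α = 4 * rounds k ε α / δ := by rw [delta', one_div_div]
    _ ≤ 4 * (14400 * (k / (ε * (24 * ε / 25) ^ 2))) / δ := by
        gcongr
        refine (rounds_le hk hε hε1 hα0 hα1).trans ?_
        gcongr
    _ = 62500 * (1 / ε) ^ 3 * (k / δ) := by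
        field_simp
        norm_num
    _ ≤ 65536 * (1 / ε) ^ 3 * (k / δ) := by
        gcongr
        norm_num

lemma log_one_div_delta'_le (hk : 2 ≤ k) (hε : 0 < ε) (hε1 : ε ≤ 1) (hδ : 0 < δ)
    (hα : 24 * ε / 25 ≤ α) (hα1 : α ≤ 1) : Real.log (1 / delta' k ε δ α) ≤
      19 * max 1 (Real.log (1 / ε)) + Real.log (k / δ) := by
  have hlog := Real.log_le_log (one_div_pos.2 (delta'_pos hk hε hε1 hδ (by linarith) hα1))
    (one_div_delta'_le hk hε hε1 hδ hα hα1)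
  have hlog16 : Real.log 65536 ≤ (16 : ℕ) := log_le_of_le_two_pow (by norm_num) (by norm_num)
  rw [Real.log_mul (by positivity) (by positivity), Real.log_mul (by positivity) (by positivity),
    Real.log_pow (1 / ε)] at hlog
  push_cast at hlog hlog16
  linarith [le_max_left 1 (Real.log (1 / ε)), le_max_right 1 (Real.log (1 / ε))]

lemma mixtureSize_le_log_div (hk : 2 ≤ k) (hε : 0 < ε) (hε1 : ε ≤ 1) (hδ : 0 < δ) (hδ1 : δ ≤ 1)
    (hα : 24 * ε / 25 ≤ α) (hα1 : α ≤ 1) : (mixtureSize k d ε δ α : ℝ) ≤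
      28800 / (α * ε) * (25 * (d * max 1 (Real.log (1 / ε))) + k * Real.log (k / δ)) := by
  have hα0 : 0 < α := by linarith
  have hlog : 0 ≤ Real.log (k / δ) :=
    (Real.log_nonneg one_le_two).trans (log_two_le_log_div hk hδ hδ1)
  rcases d.eq_zero_or_pos with rfl | hd
  · rw [mixtureSize, if_pos rfl, Nat.cast_zero]
    positivity
  have hd1 : (1 : ℝ) ≤ d := by exact_mod_cast hd
  have hk1 : (1 : ℝ) ≤ k := by exact_mod_cast one_le_two.trans hk
  calc (mixtureSize k d ε δ α : ℝ)
      ≤ 96 * (300 / (α * ε) *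
          (d * Real.log (1 / eps' ε) + Real.log (1 / delta' k ε δ α))) := by
        rw [← one_div_alpha'_mul_eps']
        exact mixtureSize_le hk hε hε1 hδ hδ1 hα0 hα1
    _ ≤ 96 * (300 / (α * ε) * (d * (6 * max 1 (Real.log (1 / ε))) +
          (d * (19 * max 1 (Real.log (1 / ε))) + k * Real.log (k / δ)))) := by
        gcongr
        · exact log_one_div_eps'_le hε
        · refine (log_one_div_delta'_le hk hε hε1 hδ hα hα1).trans (add_le_add ?_ ?_)
          · exact le_mul_of_one_le_left (by positivity) hd1
          · exact le_mul_of_one_le_left hlog hk1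
    _ = _ := by ring

theorem sampleCount_le (hk : 2 ≤ k) (hε : 0 < ε) (hε1 : ε ≤ 1) (hδ : 0 < δ) (hδ1 : δ ≤ 1)
    (hα : 24 * ε / 25 ≤ α) (hα1 : α ≤ 1) :
    (sampleCount k ε α (mixtureSize k d ε δ α) (playerSize k ε δ α) : ℝ) ≤
      10 ^ 11 * (Real.log k / (α ^ 3 * ε ^ 2) *
        (d * max 1 (Real.log (1 / ε)) + k * Real.log (k / δ))) := by
  have hα0 : 0 < α := by linarith
  have hlog : 0 ≤ Real.log (k / δ) :=
    (Real.log_nonneg one_le_two).trans (log_two_le_log_div hk hδ hδ1)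
  have hplayer := playerSize_le hk hε hε1 hδ hδ1 hα0 hα1
  rw [one_div_alpha'_mul_eps'] at hplayer
  rw [sampleCount]
  push_cast
  calc (rounds k ε α : ℝ) * (mixtureSize k d ε δ α + k * playerSize k ε δ α)
      ≤ 14400 * (Real.log k / (ε * α ^ 2)) *
        (28800 / (α * ε) * (25 * (d * max 1 (Real.log (1 / ε))) + k * Real.log (k / δ)) +
          k * (2 * (300 / (α * ε) * Real.log (k / δ)))) := by
        gcongr
        · exact rounds_le hk hε hε1 hα0 hα1
        · exact mixtureSize_le_log_div hk hε hε1 hδ hδ1 hα hα1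
    _ = Real.log k / (α ^ 3 * ε ^ 2) * (10368000000 * (d * max 1 (Real.log (1 / ε))) +
          423360000 * (k * Real.log (k / δ))) := by
        field_simp
        ring
    _ ≤ Real.log k / (α ^ 3 * ε ^ 2) * (10 ^ 11 * (d * max 1 (Real.log (1 / ε))) +
          10 ^ 11 * (k * Real.log (k / δ))) := by
        gcongr <;> norm_num
    _ = _ := by ring

lemma le_mixtureSize (hd : d ≠ 0) (hε : 0 < ε) (hα : 0 < α) {mS : ℕ}
    (hmS : mixtureSize k d ε δ α ≤ mS) :
    48 * (d * Real.log (1 / eps' ε) + Real.log (1 / delta' k ε δ α)) ≤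
      alpha' α * eps' ε * mS := by
  rw [mixtureSize, if_neg hd, Nat.ceil_le, mul_left_comm, one_div_mul_eq_div,
    div_le_iff₀' (mul_pos (alpha'_pos hα) (eps'_pos hε))] at hmS
  exact hmS

lemma log_div_alpha'_mul_eps'_le (hε : 0 < ε) (hε1 : ε ≤ 1) (hα : 24 * ε / 25 ≤ α) :
    Real.log (24 / (alpha' α * eps' ε)) ≤ 3 * Real.log (1 / eps' ε) := by
  have he := eps'_pos hε
  have ha := alpha'_pos (show 0 < α by linarith)
  have hle : 24 / (alpha' α * eps' ε) ≤ (1 / eps' ε) ^ 3 :=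
    calc 24 / (alpha' α * eps' ε) ≤ 24 / (2 * eps' ε * eps' ε) := by
          gcongr
          exact two_mul_eps'_le_alpha' hα
      _ = 12 * (1 / eps' ε) ^ 2 := by
          field_simp
          norm_num
      _ ≤ 1 / eps' ε * (1 / eps' ε) ^ 2 := by
          gcongr
          linarith [le_one_div_eps' hε hε1]
      _ = (1 / eps' ε) ^ 3 := by ring
  exact_mod_cast (Real.log_le_log (by positivity) hle).trans_eq (Real.log_pow _ _)

lemma exp_neg_le_delta' (hk : 2 ≤ k) (hε : 0 < ε) (hε1 : ε ≤ 1) (hδ : 0 < δ) (hα : 0 < α)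
    (hα1 : α ≤ 1) {x : ℝ} (hx : Real.log (1 / delta' k ε δ α) ≤ x) :
    Real.exp (-x) ≤ delta' k ε δ α := by
  rw [← Real.le_log_iff_exp_le (delta'_pos hk hε hε1 hδ hα hα1)]
  rw [one_div, Real.log_inv] at hx
  linarith

lemma exp_mixtureSize_le_delta' (hd : d ≠ 0) (hk : 2 ≤ k) (hε : 0 < ε) (hε1 : ε ≤ 1) (hδ : 0 < δ)
    (hδ1 : δ ≤ 1) (hα : 0 < α) (hα1 : α ≤ 1) {mS : ℕ} (hmS : mixtureSize k d ε δ α ≤ mS) :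
    Real.exp (-(alpha' α * eps' ε * mS)) ≤ delta' k ε δ α := by
  have hsize := le_mixtureSize hd hε hα hmS
  have hlogδ := log_one_div_delta'_nonneg hk hε hε1 hδ hδ1 hα hα1
  have hlogε : 0 ≤ d * Real.log (1 / eps' ε) :=
    mul_nonneg d.cast_nonneg (zero_le_one.trans (one_le_log_one_div_eps' hε hε1))
  exact exp_neg_le_delta' hk hε hε1 hδ hα hα1 (by linarith)

lemma pow_mul_exp_mixtureSize_le_delta' (hd : d ≠ 0) (hk : 2 ≤ k) (hε : 0 < ε) (hε1 : ε ≤ 1)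
    (hδ : 0 < δ) (hδ1 : δ ≤ 1) (hα : 24 * ε / 25 ≤ α) (hα1 : α ≤ 1) {mS : ℕ}
    (hmS : mixtureSize k d ε δ α ≤ mS) :
    (24 / (alpha' α * eps' ε)) ^ d * Real.exp (-(alpha' α * eps' ε / 12 * mS)) ≤
      delta' k ε δ α := by
  have hα0 : 0 < α := by linarith
  have hpos : 0 < 24 / (alpha' α * eps' ε) :=
    div_pos (by norm_num) (mul_pos (alpha'_pos hα0) (eps'_pos hε))
  have hsize := le_mixtureSize hd hε hα0 hmS
  have hlogδ := log_one_div_delta'_nonneg hk hε hε1 hδ hδ1 hα0 hα1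
  have hlogε : 0 ≤ d * Real.log (1 / eps' ε) :=
    mul_nonneg d.cast_nonneg (zero_le_one.trans (one_le_log_one_div_eps' hε hε1))
  have hpow : d * Real.log (24 / (alpha' α * eps' ε)) ≤ d * (3 * Real.log (1 / eps' ε)) :=
    mul_le_mul_of_nonneg_left (log_div_alpha'_mul_eps'_le hε hε1 hα) d.cast_nonneg
  calc (24 / (alpha' α * eps' ε)) ^ d * Real.exp (-(alpha' α * eps' ε / 12 * mS))
      = Real.exp (-(alpha' α * eps' ε / 12 * mS - d * Real.log (24 / (alpha' α * eps' ε)))) := by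
        rw [neg_sub, sub_eq_add_neg, Real.exp_add, Real.exp_nat_mul, Real.exp_log hpos]
    _ ≤ delta' k ε δ α := exp_neg_le_delta' hk hε hε1 hδ hα0 hα1 (by linarith)

end Sizes

section Guarantee

variable {X : Type*} [MeasurableSpace X] {k d mS mT : ℕ} {ε δ α : ℝ}
  {D : Fin k → Measure (X × Bool)} {O : (Fin mS → X × Bool) → X → Bool}

lemma potential_lt_log_add (hk : 2 ≤ k) (hε : 0 < ε) (hδ : 0 < δ) (hδ1 : δ ≤ 1) (hα : 0 < α)
    (hmT : playerSize k ε δ α ≤ mT) {i : Fin k} {t : ℕ} {h : Fin t → Round X k mS mT}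
    (hpot : mT / 2 * potential ε α D O i t h < mT / 2 * Real.log k + Real.log (2 * k / δ)) :
    potential ε α D O i t h < Real.log k + 4 * (alpha' α * eps' ε) := by
  have hlog := log_two_le_log_div hk hδ hδ1
  have hsize := le_playerSize hε hα hmT
  have hlog_two_mul : Real.log (2 * k / δ) ≤ 2 * Real.log (k / δ) := by
    rw [mul_div_assoc, Real.log_mul two_ne_zero (by positivity)]
    linarith
  have hmT0 : (0 : ℝ) < mT := by
    rcases mT.eq_zero_or_pos with rfl | hmT0
    · rw [Nat.cast_zero, mul_zero] at hsize
      linarith [Real.log_two_gt_d9]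
    · exact_mod_cast hmT0
  refine lt_of_mul_lt_mul_left (a := (mT : ℝ) / 2) ?_ (by positivity)
  linarith

lemma sum_err_div_den_le (hk : 2 ≤ k) (hε : 0 < ε) (hε1 : ε ≤ 1) (hα : 0 < α) (hα1 : α ≤ 1)
    {i : Fin k} {h : Fin (rounds k ε α) → Round X k mS mT}
    (hpot : potential ε α D O i _ h < Real.log k + 4 * (alpha' α * eps' ε)) :
    ∑ j, err (D i) (O (h j).1) / den (alpha' α) (eps' ε) (h j).1 (O (h j).1) ≤
      rounds k ε α * (1 + alpha' α) := by
  have hle := le_potential (D := D) (O := O) hε hα i h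
  have hrounds := two_mul_log_le_rounds_mul k hε hα
  have hat := le_alpha'_mul_rounds hk hε hε1 hα hα1
  have ha := alpha'_pos hα
  have ha1 : alpha' α ≤ 1 / 12 := by rw [alpha']; linarith
  have hae : 0 < eps' ε * alpha' α := mul_pos (eps'_pos hε) ha
  set a := alpha' α
  set t : ℝ := (rounds k ε α : ℝ)
  set Q := ∑ j, err (D i) (O (h j).1) / den a (eps' ε) (h j).1 (O (h j).1)
  have hQ : (1 - a / 3) * Q - t ≤ a * t / 2 + 4 := le_of_mul_le_mul_left (by linarith) hae
  have haat : a * (a * t) ≤ 1 / 12 * (a * t) := by gcongr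
  refine le_of_mul_le_mul_left (a := 1 - a / 3) ?_ (by linarith)
  linarith

lemma sum_err_le {a e B : ℝ} (ha : 0 ≤ a) (he : 0 < e) {t : ℕ} {h : Fin t → Round X k mS mT}
    (hgood : ∀ j, ∃ w, GoodRound a e B D O w (h j).1) (i : Fin k) :
    ∑ j, err (D i) (O (h j).1) ≤
      (∑ j, err (D i) (O (h j).1) / den a e (h j).1 (O (h j).1)) * ((1 + 3 * a) * B + 3 * e) := by
  rw [Finset.sum_mul]
  refine Finset.sum_le_sum fun j _ => ?_
  have hden := den_pos ha he (h j).1 (O (h j).1)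
  obtain ⟨w, hw⟩ := hgood j
  calc err (D i) (O (h j).1)
      = err (D i) (O (h j).1) / den a e (h j).1 (O (h j).1) * den a e (h j).1 (O (h j).1) :=
        (div_mul_cancel₀ _ hden.ne').symm
    _ ≤ _ := mul_le_mul_of_nonneg_left (hw.den_le ha) (div_nonneg (err_nonneg _ _) hden.le)

lemma one_add_mul_den_bound_le {a e v : ℝ} (ha : 0 ≤ a) (ha1 : a ≤ 1 / 12) (he : 0 ≤ e)
    (hv : 0 ≤ v) :
    (1 + a) * ((1 + 3 * a) * ((1 + a) * (v + e) + 2 * e) + 3 * e) ≤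
      (1 + 12 * a) * v + 25 * e := by
  have hcoeff_v : (1 + a) * (1 + 3 * a) * (1 + a) ≤ 1 + 12 * a := by nlinarith [mul_nonneg ha ha]
  have hcoeff_e : (1 + a) * ((1 + 3 * a) * (3 + a) + 3) ≤ 25 := by nlinarith [mul_nonneg ha ha]
  calc (1 + a) * ((1 + 3 * a) * ((1 + a) * (v + e) + 2 * e) + 3 * e)
      = (1 + a) * (1 + 3 * a) * (1 + a) * v + (1 + a) * ((1 + 3 * a) * (3 + a) + 3) * e := by ring
    _ ≤ (1 + 12 * a) * v + 25 * e := by gcongr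

theorem expErr_output_le (hk : 2 ≤ k) (hε : 0 < ε) (hε1 : ε ≤ 1) (hδ : 0 < δ) (hδ1 : δ ≤ 1)
    (hα : 0 < α) (hα1 : α ≤ 1) (hmT : playerSize k ε δ α ≤ mT) (F : Set (X → Bool)) {i : Fin k}
    [IsFiniteMeasure (D i)] (hO : ∀ S, Measurable (O S))
    {h : Fin (rounds k ε α) → Round X k mS mT}
    (hgood : ∀ j, ∃ w, GoodRound (alpha' α) (eps' ε)
      ((1 + alpha' α) * (opt D F + eps' ε) + 2 * eps' ε) D O w (h j).1)
    (hpot : mT / 2 * potential ε α D O i _ h < mT / 2 * Real.log k + Real.log (2 * k / δ)) :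
    expErr (D i) (output O h) ≤ (1 + α) * opt D F + ε := by
  have he := eps'_pos hε
  have ha := alpha'_pos hα
  have hopt := opt_nonneg D F
  have hrounds := one_le_rounds hk hε hε1 hα hα1
  have : NeZero (rounds k ε α) := ⟨by lia⟩
  set v := opt D F
  rw [output, expErr_uniformClassifier (D i) fun _ => hO _, div_le_iff₀' (by positivity)]
  calc ∑ j, err (D i) (O (h j).1)
      ≤ rounds k ε α * (1 + alpha' α) *
          ((1 + 3 * alpha' α) * ((1 + alpha' α) * (v + eps' ε) + 2 * eps' ε) + 3 * eps' ε) := by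
        refine (sum_err_le ha.le he hgood i).trans ?_
        gcongr
        exact sum_err_div_den_le hk hε hε1 hα hα1 (potential_lt_log_add hk hε hδ hδ1 hα hmT hpot)
    _ ≤ rounds k ε α * ((1 + 12 * alpha' α) * v + 25 * eps' ε) := by
        rw [mul_assoc]
        gcongr
        exact one_add_mul_den_bound_le ha.le (by rw [alpha']; linarith) he.le hopt
    _ = rounds k ε α * ((1 + α) * v + ε) := by
        rw [alpha', eps']
        ring

lemma failure_probability_le (hd : d ≠ 0) (hk : 2 ≤ k) (hε : 0 < ε) (hε1 : ε ≤ 1) (hδ : 0 < δ)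
    (hδ1 : δ ≤ 1) (hα : 24 * ε / 25 ≤ α) (hα1 : α ≤ 1) (hmS : mixtureSize k d ε δ α ≤ mS) :
    rounds k ε α * (ENNReal.ofReal ((24 / (alpha' α * eps' ε)) ^ d *
        Real.exp (-(alpha' α * eps' ε / 12 * mS))) +
          ENNReal.ofReal (Real.exp (-(alpha' α * eps' ε * mS)))) +
        k * ENNReal.ofReal (Real.exp (-Real.log (2 * k / δ))) ≤ ENNReal.ofReal δ := by
  have hα0 : 0 < α := by linarith
  have hδ' := delta'_pos hk hε hε1 hδ hα0 hα1
  have hrounds := one_le_rounds hk hε hε1 hα0 hα1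
  have hexp : Real.exp (-Real.log (2 * k / δ)) = δ / (2 * k) := by
    rw [Real.exp_neg, Real.exp_log (by positivity), inv_div]
  calc _ ≤ rounds k ε α * (ENNReal.ofReal (delta' k ε δ α) + ENNReal.ofReal (delta' k ε δ α)) +
          k * ENNReal.ofReal (δ / (2 * k)) := by
        rw [hexp]
        gcongr
        · exact pow_mul_exp_mixtureSize_le_delta' hd hk hε hε1 hδ hδ1 hα hα1 hmS
        · exact exp_mixtureSize_le_delta' hd hk hε hε1 hδ hδ1 hα0 hα1 hmS
    _ = ENNReal.ofReal
          (rounds k ε α * (delta' k ε δ α + delta' k ε δ α) + k * (δ / (2 * k))) := by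
        rw [ENNReal.ofReal_add (by positivity) (by positivity),
          ENNReal.ofReal_mul (Nat.cast_nonneg _), ENNReal.ofReal_mul (Nat.cast_nonneg _),
          ENNReal.ofReal_add hδ'.le hδ'.le, ENNReal.ofReal_natCast, ENNReal.ofReal_natCast]
    _ = ENNReal.ofReal δ := by
        congr 1
        rw [delta']
        field_simp
        norm_num

variable [∀ i, IsProbabilityMeasure (D i)] {F : Set (X → Bool)}

lemma le_law_expErr_output_le_of_ne_zero (hd : d ≠ 0) (hk : 2 ≤ k) (hε : 0 < ε) (hε1 : ε ≤ 1)
    (hδ : 0 < δ) (hδ1 : δ ≤ 1) (hα : 24 * ε / 25 ≤ α) (hα1 : α ≤ 1)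
    (hmS : mixtureSize k d ε δ α ≤ mS) (hmT : playerSize k ε δ α ≤ mT)
    (hFm : ∀ f ∈ F, Measurable f) (hF : HasVCDim F d) (hO : IsERM F (eps' ε) O) :
    ENNReal.ofReal (1 - δ) ≤ law (mT := mT) ε α D O (rounds k ε α)
      {h | ∀ i, expErr (D i) (output O h) ≤ (1 + α) * opt D F + ε} := by
  have hα0 : 0 < α := by linarith
  have : NeZero k := ⟨by lia⟩
  obtain ⟨f, hfF, hf⟩ := exists_err_le_opt_add D hF.nonempty (eps'_pos hε)
  rw [ENNReal.ofReal_sub _ hδ.le, ENNReal.ofReal_one]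
  refine (tsub_le_tsub_left
    (failure_probability_le hd hk hε hε1 hδ hδ1 hα hα1 hmS) 1).trans ?_
  refine (le_law_goodRound_and_potential_lt hF hε hε1 hα0 hα1 hO hfF (hFm f hfF) hf _
    (Real.log (2 * k / δ))).trans (measure_mono fun h hh i => ?_)
  exact expErr_output_le hk hε hε1 hδ hδ1 hα0 hα1 hmT F (fun S => hFm _ (hO.mem S)) hh.1 (hh.2 i)

lemma expErr_output_le_of_vcDim_zero (hε : 0 < ε) (hα : 0 ≤ α) (hFm : ∀ f ∈ F, Measurable f)
    (hF : HasVCDim F 0) (hO : ∀ S, O S ∈ F) {t : ℕ} [NeZero t] (h : Fin t → Round X k mS mT)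
    (i : Fin k) : expErr (D i) (output O h) ≤ (1 + α) * opt D F + ε := by
  obtain ⟨f, hfF, hf⟩ := exists_err_le_opt_add D hF.nonempty hε
  have houtput (S) : O S = f := hF.subsingleton (hO S) hfF
  calc expErr (D i) (output O h) = err (D i) f := by
        rw [output, expErr_uniformClassifier (D i) fun _ => hFm _ (hO _)]
        simp only [houtput, Finset.sum_const, Finset.card_univ, Fintype.card_fin, nsmul_eq_mul]
        exact mul_div_cancel_left₀ _ (NeZero.ne (t : ℝ))
    _ ≤ opt D F + ε := hf i
    _ ≤ (1 + α) * opt D F + ε := by linarith [mul_nonneg hα (opt_nonneg D F)]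

theorem le_law_expErr_output_le (hk : 2 ≤ k) (hε : 0 < ε) (hε1 : ε ≤ 1) (hδ : 0 < δ)
    (hδ1 : δ ≤ 1) (hα : 24 * ε / 25 ≤ α) (hα1 : α ≤ 1) (hmS : mixtureSize k d ε δ α ≤ mS)
    (hmT : playerSize k ε δ α ≤ mT) (hFm : ∀ f ∈ F, Measurable f) (hF : HasVCDim F d)
    (hO : IsERM F (eps' ε) O) :
    ENNReal.ofReal (1 - δ) ≤ law (mT := mT) ε α D O (rounds k ε α)
      {h | ∀ i, expErr (D i) (output O h) ≤ (1 + α) * opt D F + ε} := by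
  rcases eq_or_ne d 0 with rfl | hd
  · have hα0 : 0 < α := by linarith
    have hrounds := one_le_rounds hk hε hε1 hα0 hα1
    have : NeZero k := ⟨by lia⟩
    have : NeZero (rounds k ε α) := ⟨by lia⟩
    have huniv : {h : Fin (rounds k ε α) → Round X k mS mT |
        ∀ i, expErr (D i) (output O h) ≤ (1 + α) * opt D F + ε} = Set.univ :=
      Set.eq_univ_of_forall fun h i =>
        expErr_output_le_of_vcDim_zero hε hα0.le hFm hF hO.mem h i
    rw [huniv, law_eq_adaptiveLaw (hε := hε) (hα := hα0) (hO := hO.measurable), measure_univ,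
      ← ENNReal.ofReal_one]
    exact ENNReal.ofReal_le_ofReal (by linarith)
  · exact le_law_expErr_output_le_of_ne_zero hd hk hε hε1 hδ hδ1 hα hα1 hmS hmT hFm hF hO

end Guarantee

end CollabPAC

open CollabPAC in
theorem theorem5_general :
    ∃ (C : ℝ) (nS : ℕ → ℕ → ℝ → ℝ → ℝ → ℕ) (nT : ℕ → ℝ → ℝ → ℝ → ℕ), 0 < C ∧
      ∀ (k d : ℕ) (ε δ α : ℝ), 2 ≤ k → 0 < ε → ε < 1 → 0 < δ → δ < 1 →
        24 * ε / 25 < α → α < 1 →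
        (nS k d ε δ α : ℝ) ≤ C * (1 / (alpha' α * eps' ε) *
          (d * Real.log (1 / eps' ε) + Real.log (1 / delta' k ε δ α))) ∧
        (nT k ε δ α : ℝ) ≤ C * (1 / (alpha' α * eps' ε) * Real.log (k / delta' k ε δ α)) ∧
        (sampleCount k ε α (nS k d ε δ α) (nT k ε δ α) : ℝ) ≤
          C * (Real.log k / (α ^ 3 * ε ^ 2) *
            (d * max 1 (Real.log (1 / ε)) + k * Real.log (k / δ))) ∧
        ∀ mS mT : ℕ, nS k d ε δ α ≤ mS → nT k ε δ α ≤ mT →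
          ∀ (X : Type*) [MeasurableSpace X] (F : Set (X → Bool)),
            (∀ f ∈ F, Measurable f) → HasVCDim F d →
            ∀ D : Fin k → Measure (X × Bool), (∀ i, IsProbabilityMeasure (D i)) →
              ∀ O : (Fin mS → X × Bool) → X → Bool, IsERM F (eps' ε) O →
                ENNReal.ofReal (1 - δ) ≤
                  law (mT := mT) ε α D O (rounds k ε α)
                    {h | ∀ i, expErr (D i) (output O h) ≤ (1 + α) * opt D F + ε} := by
  refine ⟨10 ^ 11, mixtureSize, playerSize, by norm_num, ?_⟩
  intro k d ε δ α hk hε hε1 hδ hδ1 hα hα1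
  have hα0 : 0 < α := by linarith
  have hnS := mixtureSize_le (d := d) hk hε hε1.le hδ hδ1.le hα0 hα1.le
  have hnT := playerSize_le_log_div_delta' hk hε hε1.le hδ hδ1.le hα0 hα1.le
  refine ⟨?_, ?_, sampleCount_le hk hε hε1.le hδ hδ1.le hα.le hα1.le, ?_⟩
  · linarith [(mixtureSize k d ε δ α).cast_nonneg (α := ℝ)]
  · linarith [(playerSize k ε δ α).cast_nonneg (α := ℝ)]
  · intro mS mT hmS hmT X _ F hFm hF D _ O hO
    exact le_law_expErr_output_le hk hε hε1.le hδ hδ1.le hα.le hα1.le hmS hmT hFm hF hO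

open CollabPAC in
theorem theorem5 :
    ∃ (C : ℝ) (nS : ℕ → ℕ → ℝ → ℝ → ℝ → ℕ) (nT : ℕ → ℝ → ℝ → ℝ → ℕ), 0 < C ∧
      ∀ (k d : ℕ) (ε δ α : ℝ), 2 ≤ k → 0 < ε → ε < 1 → 0 < δ → δ < 1 →
        24 * ε / 25 < α → α < 1 →
        -- the sample sizes of a round
        (nS k d ε δ α : ℝ) ≤ C * (1 / (alpha' α * eps' ε) *
          (d * Real.log (1 / eps' ε) + Real.log (1 / delta' k ε δ α))) ∧
        (nT k ε δ α : ℝ) ≤ C * (1 / (alpha' α * eps' ε) * Real.log (k / delta' k ε δ α)) ∧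
        -- the total number of samples
        (sampleCount k ε α (nS k d ε δ α) (nT k ε δ α) : ℝ) ≤
          C * (Real.log k / (α ^ 3 * ε ^ 2) *
            (d * max 1 (Real.log (1 / ε)) + k * Real.log (k / δ))) ∧
        -- the error guarantee, for these sample sizes and for all larger ones
        ∀ mS mT : ℕ, nS k d ε δ α ≤ mS → nT k ε δ α ≤ mT →
          ∀ (X : Type*) [MeasurableSpace X] (F : Set (X → Bool)),
            IsMeasurableClass F → HasVCDim F d →
            ∀ D : Fin k → Measure (X × Bool), (∀ i, IsProbabilityMeasure (D i)) →
              ∀ O : (Fin mS → X × Bool) → X → Bool, IsERM F (eps' ε) O →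
                ENNReal.ofReal (1 - δ) ≤
                  law (mT := mT) ε α D O (rounds k ε α)
                    {h | ∀ i, expErr (D i) (output O h) ≤ (1 + α) * opt D F + ε} := by
  obtain ⟨C, nS, nT, hC, h⟩ := theorem5_general
  exact ⟨C, nS, nT, hC, fun k d ε δ α hk hε hε1 hδ hδ1 hα hα1 =>
    (h k d ε δ α hk hε hε1 hδ hδ1 hα hα1).imp_right <| And.imp_right <| And.imp_right
      fun h mS mT hmS hmT X _ F hF => h mS mT hmS hmT X F hF.measurable_of_mem⟩
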